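/- Let $\omega_0>0$, $\alpha_0>0$ and let $\{x_i\}_{i\ge 0}$ be positive durations following the ACD(1) model $$x_i=\psi_i\varepsilon_i,\qquad \psi_i=\omega_0+\alpha_0x_{i-1},\qquad i\ge1,$$ where the innovations $\varepsilon_1,\varepsilon_2,\dots$ are i.i.d. and strictly positive with a Lebesgue density, $\mathbb E[\varepsilon]=1$ and $\mathbb E[\varepsilon^2]<\infty$, and $\varepsilon_i$ is independent of $(x_0,\dots,x_{i-1})$ for every $i\ge 1$. Assume that $\{x_i\}$ is strictly stationary and ergodic, and that the tail index $\kappa$, i.e. the positive solution of $\mathbb E[(\alpha_0\varepsilon)^\kappa]=1$, exists and satisfies $\kappa>1$. For $T\ge0$ let $N_T=\#\{k\ge1: x_1+\dots+x_k\le T\}$ and, for $\theta=(\omega,\alpha)'$ and $\psi_i(\theta)=\omega+\alpha x_{i-1}$, let $$L_T(\theta)=-\sum_{i=1}^{N_T}\Big[\log\psi_i(\theta)+\frac{x_i}{\psi_i(\theta)}\Big].$$ With $\theta_0=(\omega_0,\alpha_0)'$, let $S_T=\partial L_T(\theta)/\partial\theta|_{\theta=\theta_0}$ be the score and $I_T=-\partial^2L_T(\theta)/\partial\theta\,\partial\theta'|_{\theta=\theta_0}$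 the information. Put $\tau=\mathbb V[\varepsilon]$, $\mu=\mathbb E[x]$, $\mathbf v_1=(1,x_0)'/\psi_1$ and $\Omega=\mathbb E[\mathbf v_1\mathbf v_1']$. Then $0<\mu<\infty$ and, as $T\to\infty$ through the reals, $$T^{-1/2}S_T\overset{d}{\to}(\tau\Omega/\mu)^{1/2}\mathbf Z,\qquad T^{-1}I_T\overset{a.s.}{\to}\Omega/\mu,\qquad N_T^{-1}I_T\overset{a.s.}{\to}\Omega,$$ where $\mathbf Z$ is a bivariate standard Gaussian vector and $(\cdot)^{1/2}$ is the symmetric positive semidefinite square root. -/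

import Mathlib

open MeasureTheory ProbabilityTheory Filter Topology
open scoped MatrixOrder

namespace ACD

/-- The conditional duration rate `ψ(θ) = ω + α y` of an ACD(1) model with parameter
`θ = (ω, α)`, where `y` is the previous duration. -/
noncomputable def rate (θ : EuclideanSpace ℝ (Fin 2)) (y : ℝ) : ℝ :=
  θ 0 + θ 1 * y

/-- The counting process `N_T = #{k ≥ 1 : x 1 + ⋯ + x k ≤ T}` of a path `x 0, x 1, x 2, …`. -/
noncomputable def count (x : ℕ → ℝ) (T : ℝ) : ℕ :=
  {k : ℕ | 1 ≤ k ∧ ∑ i ∈ Finset.Icc 1 k, x i ≤ T}.ncard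

/-- The (quasi) log-likelihood
`L_T(θ) = - ∑_{i=1}^{N_T} (log ψ_i(θ) + x_i / ψ_i(θ))`, `ψ_i(θ) = ω + α x_{i-1}`,
of a path observed over `[0, T]`. -/
noncomputable def logLik (x : ℕ → ℝ) (T : ℝ) (θ : EuclideanSpace ℝ (Fin 2)) : ℝ :=
  -∑ i ∈ Finset.range (count x T),
    (Real.log (rate θ (x i)) + x (i + 1) / rate θ (x i))

/-- The score: the gradient of `L_T` in the parameter. -/
noncomputable def score (x : ℕ → ℝ) (T : ℝ) (θ : EuclideanSpace ℝ (Fin 2)) :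
    EuclideanSpace ℝ (Fin 2) :=
  gradient (logLik x T) θ

/-- The observed information: minus the matrix of second partial derivatives of `L_T`. -/
noncomputable def information (x : ℕ → ℝ) (T : ℝ) (θ : EuclideanSpace ℝ (Fin 2)) :
    Matrix (Fin 2) (Fin 2) ℝ :=
  Matrix.of fun j k =>
    -(fderiv ℝ (fun θ' => score x T θ' k) θ (EuclideanSpace.single j 1))

/-- The vector `v = (1, y)' / (ω + α y)`. -/
noncomputable def vvec (θ : EuclideanSpace ℝ (Fin 2)) (y : ℝ) : EuclideanSpace ℝ (Fin 2) :=
  (rate θ y)⁻¹ • !₂[1, y]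

variable {Ω : Type*} [MeasurableSpace Ω]

/-- The matrix `E[v₁ v₁']`, where `v₁ = (1, x₀)' / (ω + α x₀)`. -/
noncomputable def infoMatrix (P : Measure Ω) (x : ℕ → Ω → ℝ) (θ : EuclideanSpace ℝ (Fin 2)) :
    Matrix (Fin 2) (Fin 2) ℝ :=
  Matrix.of fun j k => ∫ w, vvec θ (x 0 w) j * vvec θ (x 0 w) k ∂P

/-- `x 0, x 1, …` are positive durations following the ACD(1) equation
`x_i = (ω + α x_{i-1}) ε_i`, `i ≥ 1`, with innovations `ε_1, ε_2, …` that are i.i.d., strictly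
positive, with unit mean; `ε_i` is independent of the past `(x_0, …, x_{i-1})`.
(The value `ε 0` plays no role.) -/
structure IsACD (P : Measure Ω) (θ : EuclideanSpace ℝ (Fin 2)) (ε x : ℕ → Ω → ℝ) : Prop where
  measurable_innovation : ∀ i, Measurable (ε (i + 1))
  measurable_duration : ∀ i, Measurable (x i)
  innovation_pos : ∀ i, ∀ᵐ w ∂P, 0 < ε (i + 1) w
  iIndepFun_innovation : iIndepFun (fun i => ε (i + 1)) P
  identDistrib_innovation : ∀ i, IdentDistrib (ε (i + 1)) (ε 1) P P
  integral_innovation : ∫ w, ε 1 w ∂P = 1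
  indepFun_past : ∀ i, IndepFun (ε (i + 1)) (fun w (j : Fin (i + 1)) => x j w) P
  duration_pos : ∀ i, ∀ᵐ w ∂P, 0 < x i w
  equation : ∀ i, ∀ᵐ w ∂P, x (i + 1) w = rate θ (x i w) * ε (i + 1) w

/-- The sequence `x` is strictly stationary and ergodic: the shift on the path space preserves
the law of `x` and is ergodic for it. -/
def IsStationaryErgodic (P : Measure Ω) (x : ℕ → Ω → ℝ) : Prop :=
  Ergodic (fun (s : ℕ → ℝ) (i : ℕ) => s (i + 1)) (P.map (fun w i => x i w))

end ACD

/-! At `θ₀` the score is a sum over `i < N_T` of `(ε_{i+1} - 1) v_{i+1}`, with `v_{i+1}` a bounded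
function of `x_i`: martingale increments stopped at a random time. The information is a sum of `(2
(ε_{i+1} - 1) + 1) v v'`, whose terms have mean `Ω`.

Since `κ > 1`, strict Bernoulli forces `α₀ < 1` (`IsACD.alpha_lt_one`). Stationarity applied to
truncated durations then gives `μ < ∞` (`IsACD.integrable_duration`). Birkhoff's theorem yields the
law of large numbers for durations, which inverts to `N_T / T → 1/μ` (`tendsto_count_div`); random
time change gives both information limits.

For the score, `N_T + 1` is a stopping time: `j < N_T + 1` means `x_1 + ⋯ + x_j ≤ T`, known before
`ε_{j+1}`. Adding the negligible term `j = N_T` turns the score into a sum with predictable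
coefficients of order `T^{-1/2}`, over a deterministic range of order `T`. The sum of squared
coefficients converges almost surely, so an exponential-martingale argument identifies the limiting
characteristic function (`MartingaleCLT.tendsto_integral_cexp_sum`). Lévy's continuity theorem
concludes. -/

/-! ### Birkhoff's ergodic theorem by a maximal argument -/

namespace Birkhoff

variable {α : Type*}

/-- The running maximum `max (0, S₁ g, …, Sₙ g)` of the Birkhoff sums of `g`. -/
noncomputable def runMax (f : α → α) (g : α → ℝ) : ℕ → α → ℝ
  | 0 => fun _ => 0
  | n + 1 => fun a => max 0 (g a + runMax f g n (f a))

variable {f : α → α} {g : α → ℝ}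

lemma runMax_nonneg (n : ℕ) (a : α) : 0 ≤ runMax f g n a := by
  cases n with
  | zero => exact le_rfl
  | succ n => exact le_max_left _ _

lemma runMax_le_succ (n : ℕ) (a : α) : runMax f g n a ≤ runMax f g (n + 1) a := by
  induction n generalizing a with
  | zero => exact runMax_nonneg 1 a
  | succ n ih => exact max_le_max le_rfl (by gcongr; exact ih _)

lemma runMax_mono (a : α) : Monotone (fun n => runMax f g n a) :=
  monotone_nat_of_le_succ fun n => runMax_le_succ n a

lemma birkhoffSum_le_runMax (n : ℕ) (a : α) : birkhoffSum f g n a ≤ runMax f g n a := by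
  induction n generalizing a with
  | zero => simp [runMax]
  | succ n ih =>
    rw [birkhoffSum_succ']
    exact le_trans (by gcongr; exact ih _) (le_max_right _ _)

/-- The engine of the maximal argument: by invariance the left side has nonnegative integral, while
the right side tends to `g` wherever the running maximum diverges. -/
lemma runMax_succ_sub (n : ℕ) (a : α) :
    runMax f g (n + 1) a - runMax f g n (f a) = max (-runMax f g n (f a)) (g a) := by
  simp only [runMax]
  rw [max_sub_sub_right 0 (g a + runMax f g n (f a)) (runMax f g n (f a)) |>.symm]
  simp

lemma bddAbove_runMax_iff (a : α) :
    BddAbove (Set.range fun n => runMax f g n (f a)) ↔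
      BddAbove (Set.range fun n => runMax f g n a) := by
  constructor
  · rintro ⟨B, hB⟩
    refine ⟨max 0 (g a + B), ?_⟩
    rintro _ ⟨n, rfl⟩
    refine (runMax_le_succ n a).trans (max_le_max le_rfl ?_)
    gcongr
    exact hB ⟨n, rfl⟩
  · rintro ⟨B, hB⟩
    refine ⟨B - g a, ?_⟩
    rintro _ ⟨n, rfl⟩
    have := (le_max_right 0 (g a + runMax f g n (f a))).trans (hB ⟨n + 1, rfl⟩)
    linarith

variable [MeasurableSpace α] {μ : Measure α}

lemma measurable_runMax (hf : Measurable f) (hg : Measurable g) (n : ℕ) :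
    Measurable (runMax f g n) := by
  induction n with
  | zero => exact measurable_const
  | succ n ih => exact measurable_const.max (hg.add (ih.comp hf))

lemma integrable_runMax (hf : MeasurePreserving f μ μ) (hg : Integrable g μ) (n : ℕ) :
    Integrable (runMax f g n) μ := by
  induction n with
  | zero => exact integrable_zero _ _ _
  | succ n ih =>
    have h : Integrable (fun a => g a + runMax f g n (f a)) μ :=
      hg.add (hf.integrable_comp_of_integrable ih)
    exact (integrable_zero α ℝ μ).sup h

/-- If `g` has negative mean then its Birkhoff sums are almost surely bounded above. -/
theorem ae_bddAbove_runMax [IsProbabilityMeasure μ] (hf : Ergodic f μ) (hg : Measurable g)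
    (hgi : Integrable g μ) (hneg : ∫ a, g a ∂μ < 0) :
    ∀ᵐ a ∂μ, BddAbove (Set.range fun n => runMax f g n a) := by
  set E : Set α := {a | BddAbove (Set.range fun n => runMax f g n a)} with hE
  have hEm : MeasurableSet E :=
    measurableSet_bddAbove_range fun n => measurable_runMax hf.measurable hg n
  have hinv : f ⁻¹' E = E := by
    ext a
    exact bddAbove_runMax_iff a
  -- The event is invariant, so it has probability one or zero. In the second case the maxima
  -- diverge a.e., and the nonnegative integrals below would converge to the negative mean of `g`.
  rcases hf.toPreErgodic.ae_mem_or_ae_notMem hEm hinv with h | h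
  · exact h
  exfalso
  have hf' := hf.toMeasurePreserving
  have hfE : ∀ᵐ a ∂μ, f a ∉ E := hf'.quasiMeasurePreserving.ae h
  have hlim : Tendsto (fun n => ∫ a, max (-runMax f g n (f a)) (g a) ∂μ) atTop
      (𝓝 (∫ a, g a ∂μ)) := by
    refine tendsto_integral_of_dominated_convergence (fun a => |g a|) (fun n => ?_) hgi.abs
      (fun n => ?_) ?_
    · exact (((measurable_runMax hf.measurable hg n).comp hf.measurable).neg.max
        hg).aestronglyMeasurable
    · refine Eventually.of_forall fun a => ?_
      have := runMax_nonneg (f := f) (g := g) n (f a)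
      rw [Real.norm_eq_abs, abs_le]
      refine ⟨(neg_abs_le _).trans (le_max_right _ _), max_le ?_ (le_abs_self _)⟩
      linarith [abs_nonneg (g a)]
    · filter_upwards [hfE] with a ha
      have ht : Tendsto (fun n => runMax f g n (f a)) atTop atTop :=
        tendsto_atTop_atTop_of_monotone' (runMax_mono (f a)) ha
      refine tendsto_const_nhds.congr' ?_
      filter_upwards [ht.eventually_ge_atTop (-g a)] with n hn
      rw [max_eq_right]
      linarith
  have hnn : ∀ n, 0 ≤ ∫ a, max (-runMax f g n (f a)) (g a) ∂μ := by
    intro n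
    have hi := integrable_runMax hf' hgi n
    have hi1 := integrable_runMax hf' hgi (n + 1)
    have hcomp : ∫ a, runMax f g n (f a) ∂μ = ∫ a, runMax f g n a ∂μ := by
      conv_rhs => rw [← hf'.map_eq]
      rw [integral_map hf.measurable.aemeasurable
        (measurable_runMax hf.measurable hg n).aestronglyMeasurable]
    simp_rw [← runMax_succ_sub]
    have hic : Integrable (fun a => runMax f g n (f a)) μ := hf'.integrable_comp_of_integrable hi
    rw [integral_sub hi1 hic, hcomp, sub_nonneg]
    exact integral_mono hi hi1 fun a => runMax_le_succ n a
  exact absurd (ge_of_tendsto' hlim hnn) (not_le.mpr hneg)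

/-- For `d` strictly between the mean and `c`, the sums of `g - d` stay below some `B`, hence those
of `g` below `n d + B`, which is at most `n c` for large `n`. -/
lemma ae_eventually_birkhoffSum_le [IsProbabilityMeasure μ] (hf : Ergodic f μ)
    (hg : Measurable g) (hgi : Integrable g μ) {c : ℝ} (hc : ∫ a, g a ∂μ < c) :
    ∀ᵐ a ∂μ, ∀ᶠ n : ℕ in atTop, (n : ℝ)⁻¹ * birkhoffSum f g n a ≤ c := by
  obtain ⟨d, hd, hdc⟩ := exists_between hc
  have hneg : ∫ a, (g a - d) ∂μ < 0 := by
    rw [integral_sub hgi (integrable_const _)]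
    simp
    linarith
  filter_upwards [ae_bddAbove_runMax hf (hg.sub_const d) (hgi.sub (integrable_const d)) hneg]
    with a ⟨B, hB⟩
  have ht : Tendsto (fun n : ℕ => (n : ℝ) * (c - d)) atTop atTop :=
    tendsto_natCast_atTop_atTop.atTop_mul_const (sub_pos.mpr hdc)
  filter_upwards [ht.eventually_ge_atTop B, eventually_gt_atTop 0] with n hn hn0
  have h1 := (birkhoffSum_le_runMax (f := f) (g := fun a => g a - d) n a).trans (hB ⟨n, rfl⟩)
  have h2 : birkhoffSum f (fun a => g a - d) n a = birkhoffSum f g n a - n * d := by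
    simp [birkhoffSum, Finset.sum_sub_distrib]
  have hn' : (0 : ℝ) < n := by exact_mod_cast hn0
  rw [inv_mul_le_iff₀ hn']
  linarith

/-- **Birkhoff's pointwise ergodic theorem** for ergodic maps. -/
theorem ae_tendsto_birkhoffSum [IsProbabilityMeasure μ] (hf : Ergodic f μ)
    (hg : Measurable g) (hgi : Integrable g μ) :
    ∀ᵐ a ∂μ, Tendsto (fun n : ℕ => (n : ℝ)⁻¹ * birkhoffSum f g n a) atTop
      (𝓝 (∫ a, g a ∂μ)) := by
  have hu : ∀ k : ℕ, ∀ᵐ a ∂μ, ∀ᶠ n : ℕ in atTop,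
      (n : ℝ)⁻¹ * birkhoffSum f g n a ≤ ∫ a, g a ∂μ + 1 / ((k : ℝ) + 1) := fun k =>
    ae_eventually_birkhoffSum_le hf hg hgi (lt_add_of_pos_right _ Nat.one_div_pos_of_nat)
  have hl : ∀ k : ℕ, ∀ᵐ a ∂μ, ∀ᶠ n : ℕ in atTop,
      (n : ℝ)⁻¹ * birkhoffSum f (-g) n a ≤ ∫ a, (-g) a ∂μ + 1 / ((k : ℝ) + 1) := fun k =>
    ae_eventually_birkhoffSum_le hf hg.neg hgi.neg
      (lt_add_of_pos_right _ Nat.one_div_pos_of_nat)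
  filter_upwards [ae_all_iff.mpr hu, ae_all_iff.mpr hl] with a hua hla
  rw [Metric.tendsto_atTop']
  intro r hr
  obtain ⟨k, hk⟩ := exists_nat_one_div_lt hr
  obtain ⟨m, hm⟩ := eventually_atTop.mp ((hua k).and (hla k))
  refine ⟨m, fun n hn => ?_⟩
  obtain ⟨h1, h2⟩ := hm n hn.le
  rw [birkhoffSum_neg] at h2
  simp only [Pi.neg_apply, integral_neg, mul_neg] at h2
  rw [Real.dist_eq, abs_lt]
  constructor <;> linarith

end Birkhoff

/-! ### Inversion of partial sums into the counting process -/

namespace ACD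

section Counting

variable {x : ℕ → ℝ} {m : ℝ}

lemma tendsto_sum_atTop (hm : 0 < m)
    (hlim : Tendsto (fun n : ℕ => (n : ℝ)⁻¹ * ∑ i ∈ Finset.range n, x (i + 1)) atTop (𝓝 m)) :
    Tendsto (fun n : ℕ => ∑ i ∈ Finset.range n, x (i + 1)) atTop atTop := by
  have h := hlim.pos_mul_atTop hm (tendsto_natCast_atTop_atTop (R := ℝ))
  refine h.congr' ?_
  filter_upwards [eventually_gt_atTop 0] with n hn
  have : (n : ℝ) ≠ 0 := by positivity
  field_simp

lemma sum_Icc_eq_sum_range (k : ℕ) :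
    ∑ i ∈ Finset.Icc 1 k, x i = ∑ i ∈ Finset.range k, x (i + 1) := by
  rw [Finset.range_eq_Ico, Finset.sum_Ico_add' x 0 k 1]
  rfl

/-- Positivity makes the counted set an initial segment, and divergence makes it finite; on an
infinite set `ncard` would default to `0`. -/
lemma lt_count_iff (hpos : ∀ i, 0 < x i)
    (htop : Tendsto (fun n : ℕ => ∑ i ∈ Finset.range n, x (i + 1)) atTop atTop) {T : ℝ} {k : ℕ} :
    k < count x T ↔ ∑ i ∈ Finset.range (k + 1), x (i + 1) ≤ T := by
  have hmono : Monotone fun n : ℕ => ∑ i ∈ Finset.range n, x (i + 1) :=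
    monotone_nat_of_le_succ fun n => by
      rw [Finset.sum_range_succ]
      linarith [hpos (n + 1)]
  have hex : ∃ n : ℕ, T < ∑ i ∈ Finset.range (n + 1), x (i + 1) :=
    (((tendsto_add_atTop_iff_nat 1).mpr htop).eventually_gt_atTop T).exists
  have hlt : ∀ j, j < Nat.find hex ↔ ∑ i ∈ Finset.range (j + 1), x (i + 1) ≤ T := by
    intro j
    constructor
    · intro hj
      exact not_lt.mp (Nat.find_min hex hj)
    · intro hj
      by_contra! hle
      exact absurd (hj.trans_lt (Nat.find_spec hex)) (not_lt.mpr (hmono (by omega)))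
  have hset : {k : ℕ | 1 ≤ k ∧ ∑ i ∈ Finset.Icc 1 k, x i ≤ T} =
      ↑(Finset.Icc 1 (Nat.find hex)) := by
    ext j
    simp only [Set.mem_ofPred_eq, sum_Icc_eq_sum_range, Finset.coe_Icc, Set.mem_Icc]
    refine and_congr_right fun hj => ?_
    obtain ⟨j, rfl⟩ := Nat.exists_eq_add_of_le' hj
    rw [← hlt j, Nat.succ_le_iff]
  rw [count, hset, Set.ncard_coe_finset, Nat.card_Icc, Nat.add_sub_cancel, hlt]

/-- The shift by one matters: this event depends only on durations up to index `k`, so `N_T + 1` is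
a stopping time. The case `k = 0` needs `0 ≤ T`. -/
lemma lt_count_add_one_iff (hpos : ∀ i, 0 < x i)
    (htop : Tendsto (fun n : ℕ => ∑ i ∈ Finset.range n, x (i + 1)) atTop atTop) {T : ℝ}
    (hT : 0 ≤ T) {k : ℕ} :
    k < count x T + 1 ↔ ∑ i ∈ Finset.range k, x (i + 1) ≤ T := by
  cases k with
  | zero => simpa using hT
  | succ k => rw [← lt_count_iff hpos htop]; omega

lemma tendsto_count_atTop (hpos : ∀ i, 0 < x i)
    (htop : Tendsto (fun n : ℕ => ∑ i ∈ Finset.range n, x (i + 1)) atTop atTop) :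
    Tendsto (count x) atTop atTop := by
  refine tendsto_atTop.mpr fun k => ?_
  filter_upwards [eventually_ge_atTop (∑ i ∈ Finset.range (k + 1), x (i + 1))] with T hT
  exact ((lt_count_iff hpos htop).mpr hT).le

lemma tendsto_count_div (hpos : ∀ i, 0 < x i) (hm : 0 < m)
    (hlim : Tendsto (fun n : ℕ => (n : ℝ)⁻¹ * ∑ i ∈ Finset.range n, x (i + 1)) atTop (𝓝 m)) :
    Tendsto (fun T : ℝ => T⁻¹ * (count x T : ℝ)) atTop (𝓝 m⁻¹) := by
  have htop := tendsto_sum_atTop hm hlim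
  have hN := tendsto_count_atTop hpos htop
  have hlow := hlim.comp hN
  have hup : Tendsto (fun T : ℝ => (count x T : ℝ)⁻¹ *
      ∑ i ∈ Finset.range (count x T + 1), x (i + 1)) atTop (𝓝 m) := by
    have h1 := (hlim.comp (tendsto_add_atTop_nat 1)).mul
      (tendsto_const_nhds (x := (1 : ℝ)).add (tendsto_inv_atTop_nhds_zero_nat (𝕜 := ℝ)))
    simp only [add_zero, mul_one] at h1
    refine (h1.comp hN).congr' ?_
    filter_upwards [hN.eventually_gt_atTop 0] with T hT
    have : (count x T : ℝ) ≠ 0 := by positivity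
    simp only [Function.comp]
    push_cast
    field_simp
  -- With `S_n` the partial sums and `N = N_T`, divide `S_N ≤ T < S_{N+1}` by `N`.
  have hT : Tendsto (fun T : ℝ => (count x T : ℝ)⁻¹ * T) atTop (𝓝 m) := by
    refine tendsto_of_tendsto_of_tendsto_of_le_of_le' hlow hup ?_ ?_
    · filter_upwards [hN.eventually_gt_atTop 0] with T hT
      obtain ⟨k, hk⟩ := Nat.exists_eq_add_of_le' hT
      have := (lt_count_iff hpos htop (T := T) (k := k)).mp (by omega)
      simp only [Function.comp]
      rw [hk]
      gcongr
    · refine Eventually.of_forall fun T => ?_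
      have := (lt_count_iff hpos htop (T := T) (k := count x T)).not.mp (lt_irrefl _)
      gcongr
      exact (not_le.mp this).le
  refine (hT.inv₀ hm.ne').congr fun T => ?_
  rw [mul_inv, inv_inv, mul_comm]

end Counting

end ACD

/-! ### Score and information in closed form -/

namespace ACD

/-- The centred residual `x₁ / (ω + α x₀) - 1` of a transition from `y` to `z`. -/
noncomputable def resid (θ : EuclideanSpace ℝ (Fin 2)) (y z : ℝ) : ℝ :=
  z / rate θ y - 1

section Derivatives

variable {x : ℕ → ℝ} {T : ℝ} {θ : EuclideanSpace ℝ (Fin 2)}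

lemma rate_eq_inner (θ : EuclideanSpace ℝ (Fin 2)) (y : ℝ) :
    rate θ y = inner ℝ (!₂[1, y] : EuclideanSpace ℝ (Fin 2)) θ := by
  simp [rate, PiLp.inner_apply, Fin.sum_univ_two, mul_comm]

lemma hasFDerivAt_rate (y : ℝ) :
    HasFDerivAt (fun θ => rate θ y) (innerSL ℝ (!₂[1, y] : EuclideanSpace ℝ (Fin 2))) θ := by
  simp_rw [rate_eq_inner]
  exact (innerSL ℝ (!₂[1, y] : EuclideanSpace ℝ (Fin 2))).hasFDerivAt

lemma hasGradientAt_logLik (h : ∀ i, rate θ (x i) ≠ 0) :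
    HasGradientAt (logLik x T)
      (∑ i ∈ Finset.range (count x T), resid θ (x i) (x (i + 1)) • vvec θ (x i)) θ := by
  rw [hasGradientAt_iff_hasFDerivAt]
  have hterm : ∀ i ∈ Finset.range (count x T), HasFDerivAt
      (fun θ => Real.log (rate θ (x i)) + x (i + 1) / rate θ (x i))
      (-(InnerProductSpace.toDual ℝ _ (resid θ (x i) (x (i + 1)) • vvec θ (x i)))) θ := by
    intro i _
    have h1 := (hasFDerivAt_rate (θ := θ) (x i)).log (h i)
    have h2 := ((hasDerivAt_inv (h i)).comp_hasFDerivAt θ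
      (hasFDerivAt_rate (θ := θ) (x i))).const_mul (x (i + 1))
    refine (h1.add h2).congr_fderiv ?_
    ext u
    simp [vvec, resid]
    have := h i
    field_simp
    ring
  refine (HasFDerivAt.fun_sum hterm).neg.congr_fderiv ?_
  simp [map_sum]

lemma score_eq (h : ∀ i, rate θ (x i) ≠ 0) :
    score x T θ =
      ∑ i ∈ Finset.range (count x T), resid θ (x i) (x (i + 1)) • vvec θ (x i) :=
  (hasGradientAt_logLik h).gradient

lemma vvec_apply (y : ℝ) (k : Fin 2) :
    vvec θ y k = (rate θ y)⁻¹ * (!₂[1, y] : EuclideanSpace ℝ (Fin 2)) k := rfl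

lemma hasFDerivAt_score_term {y z : ℝ} (h : rate θ y ≠ 0) (k : Fin 2) :
    HasFDerivAt (fun θ => resid θ y z * vvec θ y k)
      (-((2 * resid θ y z + 1) * vvec θ y k * (rate θ y)⁻¹) •
        innerSL ℝ (!₂[1, y] : EuclideanSpace ℝ (Fin 2))) θ := by
  have hr := (hasDerivAt_inv h).comp_hasFDerivAt θ (hasFDerivAt_rate (θ := θ) y)
  have h1 : HasFDerivAt (fun θ => resid θ y z) _ θ := (hr.const_mul z).sub_const 1
  have h2 : HasFDerivAt (fun θ => vvec θ y k) _ θ :=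
    hr.mul_const ((!₂[1, y] : EuclideanSpace ℝ (Fin 2)) k)
  refine (h1.mul h2).congr_fderiv ?_
  ext u
  simp [vvec_apply, resid]
  field_simp
  ring

lemma rate_pos (h0 : 0 < θ 0) (h1 : 0 < θ 1) {y : ℝ} (hy : 0 < y) : 0 < rate θ y := by
  unfold rate
  positivity

lemma information_apply (h0 : 0 < θ 0) (h1 : 0 < θ 1) (hpos : ∀ i, 0 < x i) (j k : Fin 2) :
    information x T θ j k = ∑ i ∈ Finset.range (count x T),
      (2 * resid θ (x i) (x (i + 1)) + 1) * (vvec θ (x i) j * vvec θ (x i) k) := by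
  -- Differentiating the score requires its closed form on a neighbourhood, and both parameters
  -- remain positive near `θ`.
  have hnear : ∀ᶠ θ' in 𝓝 θ, 0 < θ' 0 ∧ 0 < θ' 1 :=
    (((by fun_prop : Continuous fun θ' : EuclideanSpace ℝ (Fin 2) => θ' 0).tendsto
      θ).eventually (lt_mem_nhds h0)).and
    (((by fun_prop : Continuous fun θ' : EuclideanSpace ℝ (Fin 2) => θ' 1).tendsto
      θ).eventually (lt_mem_nhds h1))
  have heq : (fun θ' => score x T θ' k) =ᶠ[𝓝 θ] fun θ' => ∑ i ∈ Finset.range (count x T),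
      resid θ' (x i) (x (i + 1)) * vvec θ' (x i) k := by
    filter_upwards [hnear] with θ' h'
    rw [score_eq fun i => (rate_pos h'.1 h'.2 (hpos i)).ne']
    simp
  have hd := HasFDerivAt.fun_sum (u := Finset.range (count x T)) fun i _ =>
    hasFDerivAt_score_term (z := x (i + 1)) (rate_pos h0 h1 (hpos i)).ne' k
  simp only [information, Matrix.of_apply]
  rw [heq.fderiv_eq, hd.fderiv, sum_apply, ← Finset.sum_neg_distrib]
  refine Finset.sum_congr rfl fun i _ => ?_
  simp [vvec_apply, PiLp.inner_apply]
  ring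

end Derivatives

end ACD

/-! ### A central limit theorem with predictable coefficients -/

namespace MartingaleCLT

open Complex

variable {Ω : Type*}

lemma re_exponent (a e τ : ℝ) : (a * e * I + τ * a ^ 2 / 2 : ℂ).re = τ * a ^ 2 / 2 := by
  have h : (a * e * I + τ * a ^ 2 / 2 : ℂ) = ((τ * a ^ 2 / 2 : ℝ) : ℂ) + ((a * e : ℝ) : ℂ) * I := by
    push_cast
    ring
  rw [h, Complex.add_re, Complex.ofReal_re, Complex.re_ofReal_mul, Complex.I_re, mul_zero, add_zero]

variable {m : ℕ → MeasurableSpace Ω} {e : ℕ → Ω → ℝ}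

/-- The exponential martingale attached to the transforms `∑ aⱼ eⱼ`, normalized by its
conditional variance. -/
noncomputable def expProc (τ : ℝ) (a e : ℕ → Ω → ℝ) (n : ℕ) (w : Ω) : ℂ :=
  cexp (∑ j ∈ Finset.range n, (a j w * e j w * I + τ * a j w ^ 2 / 2))

lemma expProc_succ (τ : ℝ) (a e : ℕ → Ω → ℝ) (n : ℕ) (w : Ω) :
    expProc τ a e (n + 1) w =
      expProc τ a e n w * cexp (a n w * e n w * I + τ * a n w ^ 2 / 2) := by
  rw [expProc, Finset.sum_range_succ, Complex.exp_add, expProc]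

lemma measurable_expProc (hmono : Monotone m) {a : ℕ → Ω → ℝ} (τ : ℝ)
    (ha : ∀ k, Measurable[m k] (a k)) (he : ∀ k, Measurable[m (k + 1)] (e k)) (n : ℕ) :
    Measurable[m n] (expProc τ a e n) := by
  have h : Measurable[m n]
      fun w => ∑ j ∈ Finset.range n, ((a j w * e j w * I + τ * a j w ^ 2 / 2 : ℂ)) := by
    refine Finset.measurable_sum _ fun j hj => ?_
    have hj := Finset.mem_range.mp hj
    have h1 : Measurable[m n] (a j) := (ha j).mono (hmono hj.le) le_rfl
    have h2 : Measurable[m n] (e j) := (he j).mono (hmono hj) le_rfl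
    have h1c : Measurable[m n] fun w => (a j w : ℂ) := Complex.measurable_ofReal.comp h1
    have h2c : Measurable[m n] fun w => (e j w : ℂ) := Complex.measurable_ofReal.comp h2
    exact ((h1c.mul h2c).mul_const I).add (((h1c.pow_const 2).const_mul _).div_const 2)
  exact Complex.measurable_exp.comp h

/-- The noise contributes only a phase, so a bound on the squared coefficients bounds the process
deterministically. -/
lemma norm_expProc (τ : ℝ) (a e : ℕ → Ω → ℝ) (n : ℕ) (w : Ω) :
    ‖expProc τ a e n w‖ = Real.exp (τ * (∑ j ∈ Finset.range n, a j w ^ 2) / 2) := by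
  rw [expProc, Complex.norm_exp, Complex.re_sum, Finset.mul_sum, Finset.sum_div]
  congr 1
  exact Finset.sum_congr rfl fun j _ => re_exponent _ _ _

lemma sum_sq_le {a : ℕ → Ω → ℝ} {η : ℝ} {w : Ω} (h : ∀ j, |a j w| ≤ η) (n : ℕ) :
    ∑ j ∈ Finset.range n, a j w ^ 2 ≤ n * η ^ 2 := by
  refine (Finset.sum_le_card_nsmul _ _ (η ^ 2) fun j _ => ?_).trans_eq (by simp)
  exact sq_le_sq' (neg_le_of_abs_le (h j)) (le_of_abs_le (h j))

variable [mΩ : MeasurableSpace Ω] {P : Measure Ω} [IsProbabilityMeasure P]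

/-- Second-order expansion at `0` of the characteristic function of a centred square-integrable
variable, normalized by the Gaussian one. -/
lemma charFun_mul_exp_sub_one_isLittleO {X : Ω → ℝ} (hX : Measurable X) (hX2 : MemLp X 2 P)
    (h0 : ∫ w, X w ∂P = 0) :
    (fun s : ℝ => charFun (P.map X) s * cexp (((∫ w, X w ^ 2 ∂P : ℝ) : ℂ) * s ^ 2 / 2) - 1)
      =o[𝓝 0] fun s : ℝ => s ^ 2 := by
  set τ : ℝ := ∫ w, X w ^ 2 ∂P with hτ
  have hP : IsProbabilityMeasure (P.map X) := Measure.isProbabilityMeasure_map hX.aemeasurable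
  have hid : MemLp id 2 (P.map X) := (memLp_map_measure_iff (by fun_prop) hX.aemeasurable).mpr hX2
  have h1 : (fun s : ℝ => charFun (P.map X) s - (1 - τ * s ^ 2 / 2)) =o[𝓝 0]
      fun s : ℝ => s ^ 2 := by
    have h := taylor_isLittleO_univ (f := charFun (P.map X)) (x₀ := (0 : ℝ)) (n := 2)
      (contDiff_charFun hid)
    simp only [sub_zero] at h
    refine h.congr_left fun s => ?_
    rw [taylorWithinEval_charFun_two_zero hX.aemeasurable hid, h0]
    simp [hτ]
  have hq : Tendsto (fun s : ℝ => (τ * s ^ 2 / 2 : ℂ)) (𝓝 0) (𝓝 0) := by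
    have : Continuous fun s : ℝ => (τ * s ^ 2 / 2 : ℂ) := by fun_prop
    simpa using this.tendsto 0
  have hqO : (fun s : ℝ => (τ * s ^ 2 / 2 : ℂ)) =O[𝓝 0] fun s : ℝ => s ^ 2 := by
    refine Asymptotics.IsBigO.of_bound (|τ| / 2) (Eventually.of_forall fun s => ?_)
    simp
    apply le_of_eq
    ring
  have h2 : (fun s : ℝ => cexp (τ * s ^ 2 / 2) - (1 + τ * s ^ 2 / 2)) =o[𝓝 0]
      fun s : ℝ => s ^ 2 := by
    have hd : HasDerivAt cexp 1 0 := by simpa using Complex.hasDerivAt_exp 0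
    rw [hasDerivAt_iff_isLittleO] at hd
    have h := hd.comp_tendsto hq
    simp only [Function.comp_def, sub_zero, Complex.exp_zero, smul_eq_mul, mul_one] at h
    exact (h.trans_isBigO hqO).congr_left fun s => by ring
  have hE : Tendsto (fun s : ℝ => cexp (τ * s ^ 2 / 2)) (𝓝 0) (𝓝 1) := by
    simpa [Function.comp_def] using (Complex.continuous_exp.tendsto 0).comp hq
  -- With `q = τ s² / 2`, `E = exp q` and `φ` the characteristic function: `φ E - 1 = (φ - (1 - q))
  -- E + (1 - q) (E - (1 + q)) - q²`.
  have hA := h1.mul_isBigO (hE.isBigO_one ℝ)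
  have hB := ((tendsto_const_nhds (x := (1 : ℂ))).sub hq).isBigO_one ℝ |>.mul_isLittleO h2
  have hC := hqO.mul_isLittleO ((Asymptotics.isLittleO_one_iff ℝ).mpr hq)
  simp only [mul_one, one_mul] at hA hB hC
  refine ((hA.add hB).sub hC).congr_left fun s => ?_
  ring

/-- One step of the martingale argument: freezing the past. -/
lemma norm_integral_step {Z : Ω → ℂ} {a e : Ω → ℝ} (hZ : Measurable Z) (ha : Measurable a)
    (he : Measurable e) (hind : IndepFun (fun w => (Z w, a w)) e P) {B η δ τ : ℝ}
    (hZB : ∀ᵐ w ∂P, ‖Z w‖ ≤ B) (haη : ∀ᵐ w ∂P, |a w| ≤ η)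
    (hφ : ∀ s : ℝ, |s| ≤ η → ‖charFun (P.map e) s * cexp ((τ : ℂ) * s ^ 2 / 2) - 1‖ ≤ δ) :
    ‖∫ w, Z w * cexp (a w * e w * I + τ * a w ^ 2 / 2) ∂P - ∫ w, Z w ∂P‖ ≤ B * δ := by
  have hU : Measurable fun w => (Z w, a w) := hZ.prodMk ha
  have hQ : IsProbabilityMeasure (P.map fun w => (Z w, a w)) :=
    Measure.isProbabilityMeasure_map hU.aemeasurable
  have hE : IsProbabilityMeasure (P.map e) := Measure.isProbabilityMeasure_map he.aemeasurable
  have hlaw := (indepFun_iff_map_prod_eq_prod_map_map hU.aemeasurable he.aemeasurable).mp hind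
  set G : (ℂ × ℝ) × ℝ → ℂ := fun q =>
    q.1.1 * cexp (q.1.2 * q.2 * I + τ * q.1.2 ^ 2 / 2) - q.1.1 with hG
  have hGm : Measurable G := by
    rw [hG]
    fun_prop
  have hZi : Integrable Z P := .of_bound hZ.aestronglyMeasurable B hZB
  have hcm : Measurable fun w => Z w * cexp (a w * e w * I + τ * a w ^ 2 / 2) := by fun_prop
  have hci : Integrable (fun w => Z w * cexp (a w * e w * I + τ * a w ^ 2 / 2)) P := by
    refine .of_bound hcm.aestronglyMeasurable (B * Real.exp (|τ| * η ^ 2 / 2)) ?_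
    filter_upwards [hZB, haη] with w h1 h2
    rw [norm_mul]
    have h3 : ‖cexp (a w * e w * I + τ * a w ^ 2 / 2)‖ ≤ Real.exp (|τ| * η ^ 2 / 2) := by
      rw [Complex.norm_exp, re_exponent]
      have : a w ^ 2 ≤ η ^ 2 := sq_le_sq' (neg_le_of_abs_le h2) (le_of_abs_le h2)
      gcongr
      exact le_abs_self _
    exact mul_le_mul h1 h3 (norm_nonneg _) ((norm_nonneg _).trans h1)
  have hGi : Integrable G ((P.map fun w => (Z w, a w)).prod (P.map e)) := by
    rw [← hlaw, integrable_map_measure hGm.aestronglyMeasurable (hU.prodMk he).aemeasurable]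
    exact hci.sub hZi
  rw [← integral_sub hci hZi]
  -- By independence the joint law is a product; integrating `e` out with `(Z, a)` fixed produces
  -- its characteristic function at `a`.
  have hstep : ∫ w, (Z w * cexp (a w * e w * I + τ * a w ^ 2 / 2) - Z w) ∂P =
      ∫ u, u.1 * (charFun (P.map e) u.2 * cexp ((τ : ℂ) * u.2 ^ 2 / 2) - 1)
        ∂(P.map fun w => (Z w, a w)) := by
    have h1 : ∫ w, (Z w * cexp (a w * e w * I + τ * a w ^ 2 / 2) - Z w) ∂P =
        ∫ q, G q ∂(P.map fun w => ((Z w, a w), e w)) := by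
      rw [integral_map (hU.prodMk he).aemeasurable hGm.aestronglyMeasurable]
    rw [h1, hlaw, integral_prod _ hGi]
    refine integral_congr_ae (Eventually.of_forall fun u => ?_)
    simp only [hG]
    have hb : Integrable (fun y : ℝ => cexp (u.2 * y * I)) (P.map e) := by
      refine .of_bound (by fun_prop) 1 (Eventually.of_forall fun y => ?_)
      rw [← ofReal_mul, norm_exp_ofReal_mul_I]
    rw [charFun_apply_real]
    simp_rw [Complex.exp_add, ← mul_assoc]
    rw [integral_sub ((hb.const_mul u.1).mul_const _) (integrable_const _),
      integral_mul_const, integral_const_mul]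
    simp
    ring
  rw [hstep]
  refine (norm_integral_le_of_norm_le_const (C := B * δ) ?_).trans (by simp)
  refine (ae_map_iff hU.aemeasurable ?_).mpr ?_
  · exact measurableSet_le (by fun_prop) measurable_const
  filter_upwards [hZB, haη] with w h1 h2
  rw [norm_mul]
  exact mul_le_mul h1 (hφ _ h2) (norm_nonneg _) ((norm_nonneg _).trans h1)

/-- The expectation starts at `1`, and each factor moves it by at most the uniform norm bound times
`δ`. -/
lemma norm_integral_expProc_sub_one (hm : ∀ k, m k ≤ mΩ) (hmono : Monotone m) {a : ℕ → Ω → ℝ}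
    {τ η δ : ℝ} (hτ : 0 ≤ τ)
    (ha : ∀ k, Measurable[m k] (a k)) (he : ∀ k, Measurable[m (k + 1)] (e k))
    (hind : ∀ k, Indep (m k) (MeasurableSpace.comap (e k) inferInstance) P)
    (hlaw : ∀ k, P.map (e k) = P.map (e 0))
    (haη : ∀ᵐ w ∂P, ∀ j, |a j w| ≤ η)
    (hφ : ∀ s : ℝ, |s| ≤ η →
      ‖charFun (P.map (e 0)) s * cexp ((τ : ℂ) * s ^ 2 / 2) - 1‖ ≤ δ) {K n : ℕ} (hn : n ≤ K) :
    ‖∫ w, expProc τ a e n w ∂P - 1‖ ≤ n * (Real.exp (τ * (K * η ^ 2) / 2) * δ) := by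
  induction n with
  | zero => simp [expProc]
  | succ n ih =>
    have hZm := measurable_expProc hmono τ ha he n
    have hind' : IndepFun (fun w => (expProc τ a e n w, a n w)) (e n) P := by
      rw [IndepFun_iff_Indep]
      refine indep_of_indep_of_le_left (hind n) ?_
      exact measurable_iff_comap_le.mp (hZm.prodMk (ha n))
    have hB : ∀ᵐ w ∂P, ‖expProc τ a e n w‖ ≤ Real.exp (τ * (K * η ^ 2) / 2) := by
      filter_upwards [haη] with w hw
      rw [norm_expProc]
      have := sum_sq_le hw n
      have hnK : (n : ℝ) * η ^ 2 ≤ K * η ^ 2 := by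
        gcongr
        omega
      gcongr
      exact this.trans hnK
    have hstep := norm_integral_step (hZm.mono (hm n) le_rfl) ((ha n).mono (hm n) le_rfl)
      ((he n).mono (hm _) le_rfl) hind' hB (haη.mono fun w hw => hw n) (τ := τ)
      (by rw [hlaw n]; exact hφ)
    simp_rw [expProc_succ]
    calc _ ≤ _ := norm_sub_le_norm_sub_add_norm_sub _ (∫ w, expProc τ a e n w ∂P) _
      _ ≤ _ := add_le_add hstep (ih (by omega))
      _ = _ := by
        push_cast
        ring

/-- A central limit theorem for sums `∑_{j < K_T} a_{T,j} eⱼ` whose coefficients are uniformly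
small and known before `eⱼ`, and whose conditional variance converges almost surely. -/
theorem tendsto_integral_cexp_sum (hm : ∀ k, m k ≤ mΩ) (hmono : Monotone m)
    {a : ℝ → ℕ → Ω → ℝ} {K : ℝ → ℕ} {η : ℝ → ℝ} {D v : ℝ}
    (ha : ∀ T k, Measurable[m k] (a T k)) (he : ∀ k, Measurable[m (k + 1)] (e k))
    (hind : ∀ k, Indep (m k) (MeasurableSpace.comap (e k) inferInstance) P)
    (hlaw : ∀ k, P.map (e k) = P.map (e 0)) (he2 : MemLp (e 0) 2 P) (he0 : ∫ w, e 0 w ∂P = 0)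
    (haη : ∀ T, ∀ᵐ w ∂P, ∀ j, |a T j w| ≤ η T) (hη : Tendsto η atTop (𝓝 0))
    (hK : ∀ᶠ T in atTop, K T * η T ^ 2 ≤ D)
    (hV : ∀ᵐ w ∂P, Tendsto (fun T => (∫ w, e 0 w ^ 2 ∂P) *
      ∑ j ∈ Finset.range (K T), a T j w ^ 2) atTop (𝓝 v)) :
    Tendsto (fun T => ∫ w, cexp (((∑ j ∈ Finset.range (K T), a T j w * e j w : ℝ) : ℂ) * I) ∂P)
      atTop (𝓝 (cexp (-(v / 2 : ℝ)))) := by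
  set τ : ℝ := ∫ w, e 0 w ^ 2 ∂P with hτ
  have hτ0 : 0 ≤ τ := integral_nonneg fun w => sq_nonneg _
  have hem : ∀ k, Measurable (e k) := fun k => (he k).mono (hm _) le_rfl
  have ham : ∀ T k, Measurable (a T k) := fun T k => (ha T k).mono (hm _) le_rfl
  have hZm : ∀ T, Measurable (expProc τ (a T) e (K T)) := fun T =>
    (measurable_expProc hmono τ (ha T) he (K T)).mono (hm _) le_rfl
  have hZ : Tendsto (fun T => ∫ w, expProc τ (a T) e (K T) w ∂P - 1) atTop (𝓝 0) := by
    have hlit := charFun_mul_exp_sub_one_isLittleO (hem 0) he2 he0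
    rw [← hτ] at hlit
    rw [Metric.tendsto_nhds]
    intro r hr
    -- The one-step error is `δ = ρ η²`; summed over `K` steps with `K η² ≤ D`, the total is at most
    -- the left side.
    obtain ⟨ρ, hρ, hρr⟩ : ∃ ρ > 0, |D| * Real.exp (τ * |D| / 2) * ρ < r := by
      have hc : 0 < |D| * Real.exp (τ * |D| / 2) + 1 := by positivity
      refine ⟨r / (|D| * Real.exp (τ * |D| / 2) + 1), by positivity, ?_⟩
      rw [mul_div_assoc', div_lt_iff₀ hc]
      nlinarith
    obtain ⟨u, hu, hball⟩ := Metric.eventually_nhds_iff.mp (hlit.bound hρ)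
    filter_upwards [hK, hη.eventually (Metric.ball_mem_nhds 0 hu)] with T hT hTu
    have hηu : |η T| < u := by simpa [Real.dist_eq] using hTu
    have hDT : (K T : ℝ) * η T ^ 2 ≤ |D| := hT.trans (le_abs_self D)
    have hφ : ∀ s : ℝ, |s| ≤ η T →
        ‖charFun (P.map (e 0)) s * cexp ((τ : ℂ) * s ^ 2 / 2) - 1‖ ≤ ρ * η T ^ 2 := by
      intro s hs
      have h1 := hball (y := s) (by
        simpa [Real.dist_eq] using hs.trans_lt ((le_abs_self _).trans_lt hηu))
      refine h1.trans ?_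
      rw [Real.norm_eq_abs, abs_pow]
      gcongr
    have h := norm_integral_expProc_sub_one hm hmono hτ0 (ha T) he hind hlaw
      (haη T) hφ (le_refl (K T))
    rw [dist_zero_right]
    refine h.trans_lt (lt_of_le_of_lt ?_ hρr)
    calc (K T : ℝ) * (Real.exp (τ * (K T * η T ^ 2) / 2) * (ρ * η T ^ 2))
        = (K T * η T ^ 2) * Real.exp (τ * (K T * η T ^ 2) / 2) * ρ := by ring
      _ ≤ _ := by gcongr
  have hcm : ∀ T, Measurable fun w =>
      cexp (((∑ j ∈ Finset.range (K T), a T j w * e j w : ℝ) : ℂ) * I) := by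
    intro T
    have : Measurable fun w => ∑ j ∈ Finset.range (K T), a T j w * e j w :=
      Finset.measurable_sum _ fun j _ => (ham T j).mul (hem j)
    fun_prop
  have hfac : ∀ T w, expProc τ (a T) e (K T) w =
      cexp (((∑ j ∈ Finset.range (K T), a T j w * e j w : ℝ) : ℂ) * I) *
        (Real.exp (τ * (∑ j ∈ Finset.range (K T), a T j w ^ 2) / 2) : ℂ) := by
    intro T w
    rw [expProc, Complex.ofReal_exp, ← Complex.exp_add]
    push_cast
    rw [Finset.sum_add_distrib, Finset.sum_mul, Finset.mul_sum, Finset.sum_div]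
  -- The normalizing factor `exp (τ ∑ a² / 2)` tends to `exp (v / 2)` almost surely and may be
  -- replaced by it under the integral.
  have hdiff : Tendsto (fun T => ∫ w,
      (cexp (((∑ j ∈ Finset.range (K T), a T j w * e j w : ℝ) : ℂ) * I) * (Real.exp (v / 2) : ℂ) -
        expProc τ (a T) e (K T) w) ∂P) atTop (𝓝 0) := by
    have : (0 : ℂ) = ∫ _ : Ω, 0 ∂P := by simp
    rw [this]
    refine tendsto_integral_filter_of_dominated_convergence
      (fun _ => Real.exp (v / 2) + Real.exp (τ * D / 2)) ?_ ?_ (integrable_const _) ?_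
    · exact Eventually.of_forall fun T =>
        (((hcm T).mul_const _).sub (hZm T)).aestronglyMeasurable
    · filter_upwards [hK] with T hT
      filter_upwards [haη T] with w hw
      refine (norm_sub_le _ _).trans ?_
      rw [norm_mul, norm_exp_ofReal_mul_I, norm_expProc, one_mul, Complex.norm_real,
        Real.norm_of_nonneg (Real.exp_pos _).le]
      have := (sum_sq_le hw (K T)).trans hT
      gcongr
    · filter_upwards [hV] with w hw
      rw [tendsto_zero_iff_norm_tendsto_zero]
      have h1 : Tendsto (fun T => Real.exp (v / 2) -
          Real.exp (τ * (∑ j ∈ Finset.range (K T), a T j w ^ 2) / 2)) atTop (𝓝 0) := by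
        have h2 := ((Real.continuous_exp.tendsto _).comp (hw.div_const 2)).const_sub
          (Real.exp (v / 2))
        simpa using h2
      refine (tendsto_zero_iff_norm_tendsto_zero.mp h1).congr fun T => ?_
      rw [hfac, ← mul_sub, norm_mul, norm_exp_ofReal_mul_I, one_mul, ← Complex.ofReal_sub,
        Complex.norm_real]
  have hsum := (hdiff.add hZ).const_mul (cexp (-(v / 2 : ℝ)))
  simp only [add_zero, mul_zero] at hsum
  have hfin := hsum.add_const (cexp (-(v / 2 : ℝ)))
  rw [zero_add] at hfin
  refine hfin.congr' ?_
  filter_upwards [hK] with T hT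
  have hi1 : Integrable (fun w =>
      cexp (((∑ j ∈ Finset.range (K T), a T j w * e j w : ℝ) : ℂ) * I)) P :=
    .of_bound (hcm T).aestronglyMeasurable 1
      (Eventually.of_forall fun w => (norm_exp_ofReal_mul_I _).le)
  have hi2 : Integrable (expProc τ (a T) e (K T)) P := by
    refine .of_bound (hZm T).aestronglyMeasurable (Real.exp (τ * D / 2)) ?_
    filter_upwards [haη T] with w hw
    rw [norm_expProc]
    have := (sum_sq_le hw (K T)).trans hT
    gcongr
  rw [integral_sub (hi1.mul_const _) hi2, integral_mul_const]
  have hexp : cexp (-(v / 2 : ℝ)) * (Real.exp (v / 2) : ℂ) = 1 := by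
    rw [Complex.ofReal_exp, ← Complex.exp_add]
    simp
  linear_combination (∫ w, cexp (((∑ j ∈ Finset.range (K T), a T j w * e j w : ℝ) : ℂ) * I) ∂P) *
    hexp

end MartingaleCLT

/-! ### Finite mean and ergodic averages of the durations -/

namespace ACD

variable {Ω : Type*} [MeasurableSpace Ω] {P : Measure Ω} {θ : EuclideanSpace ℝ (Fin 2)} {ε x : ℕ → Ω → ℝ}

lemma IsACD.ae_pos (hx : IsACD P θ ε x) : ∀ᵐ w ∂P, ∀ i, 0 < x i w :=
  ae_all_iff.mpr hx.duration_pos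

lemma IsACD.integrable_innovation (hx : IsACD P θ ε x) : Integrable (ε 1) P :=
  .of_integral_ne_zero (by rw [hx.integral_innovation]; exact one_ne_zero)

/-- The tail-index condition `E (α ε) ^ κ = 1` with `κ > 1` forces `α < 1`. -/
lemma IsACD.alpha_lt_one [IsProbabilityMeasure P] (hx : IsACD P θ ε x) (hdens : HasPDF (ε 1) P volume)
    {α κ : ℝ} (hα : 0 < α) (hκ : 1 < κ) (hκ_eq : ∫ w, (α * ε 1 w) ^ κ ∂P = 1) : α < 1 := by
  by_contra! h1
  have hi := hx.integrable_innovation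
  -- A nonintegrable function would have integral `0` by convention, not `1`.
  have hiκ : Integrable (fun w => (α * ε 1 w) ^ κ) P :=
    .of_integral_ne_zero (by rw [hκ_eq]; exact one_ne_zero)
  have hne : ∀ᵐ w ∂P, α * ε 1 w ≠ 1 := by
    have h0 : P.map (ε 1) {α⁻¹} = 0 := hdens.absolutelyContinuous (by simp)
    rw [Measure.map_apply (hx.measurable_innovation 0) (measurableSet_singleton _)] at h0
    filter_upwards [measure_eq_zero_iff_ae_notMem.mp h0] with w hw h
    exact hw (eq_inv_of_mul_eq_one_right h)
  -- Strict Bernoulli away from `1`, a value the density excludes. The mean of this positive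
  -- quantity is `-κ (α - 1)`, impossible if `1 ≤ α`.
  have hpos : ∀ᵐ w ∂P, 0 < (α * ε 1 w) ^ κ - (1 + κ * (α * ε 1 w - 1)) := by
    filter_upwards [hne, hx.innovation_pos 0] with w hw hw0
    have hw0' : 0 < α * ε 1 w := mul_pos hα hw0
    have := one_add_mul_self_lt_rpow_one_add (s := α * ε 1 w - 1) (by linarith)
      (sub_ne_zero.mpr hw) hκ
    rw [add_sub_cancel] at this
    linarith
  have hli : Integrable (fun w => 1 + κ * (α * ε 1 w - 1)) P :=
    (integrable_const _).add (((hi.const_mul α).sub (integrable_const _)).const_mul κ)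
  have hint : ∫ w, ((α * ε 1 w) ^ κ - (1 + κ * (α * ε 1 w - 1))) ∂P = -(κ * (α - 1)) := by
    have hα1 : Integrable (fun w => α * ε 1 w - 1) P := (hi.const_mul α).sub (integrable_const _)
    rw [integral_sub hiκ hli, hκ_eq, integral_add (integrable_const _) (hα1.const_mul κ),
      integral_const_mul, integral_sub (hi.const_mul α) (integrable_const _), integral_const_mul,
      hx.integral_innovation]
    simp
  have hnn := integral_nonneg_of_ae (hpos.mono fun w hw => hw.le)
  have hzero : ∫ w, ((α * ε 1 w) ^ κ - (1 + κ * (α * ε 1 w - 1))) ∂P = 0 := by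
    refine le_antisymm ?_ hnn
    rw [hint]
    nlinarith
  rw [integral_eq_zero_iff_of_nonneg_ae (hpos.mono fun w hw => hw.le) (hiκ.sub hli)] at hzero
  obtain ⟨w, hw1, hw2⟩ := (hpos.and hzero).exists
  exact hw1.ne' hw2

lemma measurable_shift : Measurable fun (s : ℕ → ℝ) (i : ℕ) => s (i + 1) := by fun_prop

lemma shift_iterate (n : ℕ) (s : ℕ → ℝ) (i : ℕ) :
    (fun (s : ℕ → ℝ) (i : ℕ) => s (i + 1))^[n] s i = s (i + n) := by
  induction n generalizing s with
  | zero => rfl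
  | succ n ih => rw [Function.iterate_succ_apply, ih, ← Nat.add_assoc]

/-- Birkhoff's theorem along a stationary ergodic sequence, for functions of two consecutive
values. -/
theorem IsStationaryErgodic.ae_tendsto [IsProbabilityMeasure P] (herg : IsStationaryErgodic P x)
    (hm : ∀ i, Measurable (x i)) {F : ℝ × ℝ → ℝ} (hF : Measurable F)
    (hFi : Integrable (fun w => F (x 0 w, x 1 w)) P) :
    ∀ᵐ w ∂P, Tendsto (fun n : ℕ => (n : ℝ)⁻¹ * ∑ i ∈ Finset.range n, F (x i w, x (i + 1) w))
      atTop (𝓝 (∫ w, F (x 0 w, x 1 w) ∂P)) := by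
  have hpath : Measurable fun w i => x i w := measurable_pi_lambda _ hm
  have hprob := Measure.isProbabilityMeasure_map (μ := P) hpath.aemeasurable
  have hG : Measurable fun s : ℕ → ℝ => F (s 0, s 1) := by fun_prop
  have hGi : Integrable (fun s : ℕ → ℝ => F (s 0, s 1)) (P.map fun w i => x i w) := by
    rw [integrable_map_measure hG.aestronglyMeasurable hpath.aemeasurable]
    exact hFi
  have h := ae_of_ae_map hpath.aemeasurable (Birkhoff.ae_tendsto_birkhoffSum herg hG hGi)
  rw [integral_map hpath.aemeasurable hG.aestronglyMeasurable] at h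
  filter_upwards [h] with w hw
  refine hw.congr fun n => ?_
  simp only [birkhoffSum, shift_iterate, zero_add, add_comm 1]

lemma IsStationaryErgodic.map_eq (herg : IsStationaryErgodic P x)
    (hm : ∀ i, Measurable (x i)) : P.map (x 1) = P.map (x 0) := by
  have hpath : Measurable fun w i => x i w := measurable_pi_lambda _ hm
  have h := herg.toMeasurePreserving.map_eq
  have h0 : (P.map fun w i => x i w).map (fun s : ℕ → ℝ => s 0) = P.map (x 0) :=
    Measure.map_map (by fun_prop) hpath
  rw [← h0]
  conv_rhs => rw [← h]
  rw [Measure.map_map (by fun_prop) measurable_shift, Measure.map_map (by fun_prop) hpath]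
  rfl

lemma IsACD.indepFun_last (hx : IsACD P θ ε x) (i : ℕ) : IndepFun (ε (i + 1)) (x i) P :=
  (hx.indepFun_past i).comp measurable_id (measurable_pi_apply (Fin.last i))

lemma measurable_rate (θ : EuclideanSpace ℝ (Fin 2)) : Measurable (rate θ) := by
  unfold rate
  fun_prop

/-- Jensen's inequality given `x 0`, for the concave truncation and an innovation of mean one.
Truncating avoids presupposing a finite mean. -/
lemma IsACD.integral_min_le [IsProbabilityMeasure P] (hx : IsACD P θ ε x) (h0 : 0 < θ 0) (h1 : 0 < θ 1)
    {M : ℝ} (hM : 0 < M) :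
    ∫ w, min (x 1 w) M ∂P ≤ ∫ w, min (rate θ (x 0 w)) M ∂P := by
  have hx0 := hx.measurable_duration 0
  have hε := hx.measurable_innovation 0
  have hr := measurable_rate θ
  have hlaw := (indepFun_iff_map_prod_eq_prod_map_map hx0.aemeasurable hε.aemeasurable).mp
    (hx.indepFun_last 0).symm
  have hX : IsProbabilityMeasure (P.map (x 0)) :=
    Measure.isProbabilityMeasure_map hx0.aemeasurable
  have hE : IsProbabilityMeasure (P.map (ε (0 + 1))) :=
    Measure.isProbabilityMeasure_map hε.aemeasurable
  have hGm : Measurable fun q : ℝ × ℝ => min (rate θ q.1 * q.2) M := by fun_prop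
  have hbd : ∀ {u y : ℝ}, 0 < u → 0 < y → ‖min (rate θ u * y) M‖ ≤ M := by
    intro u y hu hy
    have := mul_pos (rate_pos h0 h1 hu) hy
    rw [Real.norm_of_nonneg (le_min this.le hM.le)]
    exact min_le_right _ _
  have hGi : Integrable (fun q : ℝ × ℝ => min (rate θ q.1 * q.2) M)
      ((P.map (x 0)).prod (P.map (ε (0 + 1)))) := by
    rw [← hlaw, integrable_map_measure hGm.aestronglyMeasurable (hx0.prodMk hε).aemeasurable]
    refine .of_bound (hGm.comp (hx0.prodMk hε)).aestronglyMeasurable M ?_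
    filter_upwards [hx.duration_pos 0, hx.innovation_pos 0] with w hw1 hw2
    exact hbd hw1 hw2
  have hi := hx.integrable_innovation
  have hid : Integrable id (P.map (ε (0 + 1))) :=
    (integrable_map_measure measurable_id.aestronglyMeasurable hε.aemeasurable).mpr hi
  have hposE : ∀ᵐ y ∂P.map (ε (0 + 1)), 0 < y :=
    (ae_map_iff hε.aemeasurable measurableSet_Ioi).mpr (hx.innovation_pos 0)
  have hposX : ∀ᵐ u ∂P.map (x 0), 0 < u :=
    (ae_map_iff hx0.aemeasurable measurableSet_Ioi).mpr (hx.duration_pos 0)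
  have hmean : ∫ y, y ∂P.map (ε (0 + 1)) = 1 := by
    rw [integral_map hε.aemeasurable (by fun_prop)]
    exact hx.integral_innovation
  have hmr : Measurable fun u => min (rate θ u) M := by fun_prop
  calc ∫ w, min (x 1 w) M ∂P = ∫ w, min (rate θ (x 0 w) * ε (0 + 1) w) M ∂P := by
        refine integral_congr_ae ?_
        filter_upwards [hx.equation 0] with w hw
        rw [← hw]
    _ = ∫ q, min (rate θ q.1 * q.2) M ∂P.map fun w => (x 0 w, ε (0 + 1) w) := by
        rw [integral_map (hx0.prodMk hε).aemeasurable hGm.aestronglyMeasurable]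
    _ = ∫ u, ∫ y, min (rate θ u * y) M ∂P.map (ε (0 + 1)) ∂P.map (x 0) := by
        rw [hlaw, integral_prod _ hGi]
    _ ≤ ∫ u, min (rate θ u) M ∂P.map (x 0) := by
        refine integral_mono_ae hGi.integral_prod_left ?_ ?_
        · refine .of_bound hmr.aestronglyMeasurable M ?_
          filter_upwards [hposX] with u hu
          simpa using hbd hu one_pos
        · filter_upwards [hposX, hGi.prod_right_ae] with u hu hui
          have h2 : ∫ y, rate θ u * y ∂P.map (ε (0 + 1)) = rate θ u := by
            rw [integral_const_mul, hmean, mul_one]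
          refine le_min ?_ ?_
          · exact (integral_mono hui (hid.const_mul (rate θ u))
              fun y => min_le_left _ _).trans_eq h2
          · refine (integral_mono hui (integrable_const M) fun y => min_le_right _ _).trans_eq ?_
            simp
    _ = _ := integral_map hx0.aemeasurable hmr.aestronglyMeasurable

/-- A stationary ACD(1) sequence with `α < 1` has finite mean. -/
theorem IsACD.integrable_duration [IsProbabilityMeasure P] (hx : IsACD P θ ε x) (herg : IsStationaryErgodic P x)
    (h0 : 0 < θ 0) (h1 : 0 < θ 1) (hlt : θ 1 < 1) : Integrable (x 0) P := by
  have hx0 := hx.measurable_duration 0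
  have hcov : AECover P atTop fun n : ℕ => {w | x 0 w ≤ (n : ℝ) + 1} := by
    refine ⟨Eventually.of_forall fun w => ?_, fun n => measurableSet_le hx0 measurable_const⟩
    filter_upwards [tendsto_natCast_atTop_atTop.eventually_ge_atTop (x 0 w)] with n hn
    exact hn.trans (by simp)
  have hon : ∀ n : ℕ, IntegrableOn (x 0) {w | x 0 w ≤ (n : ℝ) + 1} P := by
    intro n
    refine Measure.integrableOn_of_bounded (M := (n : ℝ) + 1) (by finiteness)
      hx0.aestronglyMeasurable ?_
    filter_upwards [ae_restrict_mem (hcov.measurableSet n),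
      ae_restrict_of_ae (hx.duration_pos 0)] with w hw1 hw2
    rw [Real.norm_of_nonneg hw2.le]
    exact hw1
  refine hcov.integrable_of_integral_bounded_of_nonneg_ae (θ 0 / (1 - θ 1)) hon
    ((hx.duration_pos 0).mono fun w hw => hw.le) (Eventually.of_forall fun n => ?_)
  set M : ℝ := (n : ℝ) + 1 with hM
  have hM0 : 0 < M := by positivity
  set A : Set Ω := {w | x 0 w ≤ M} with hA
  have hAm : MeasurableSet A := hcov.measurableSet n
  have hmin : Measurable fun y : ℝ => min y M := by fun_prop
  have hbd : ∀ {y : ℝ}, 0 < y → ‖min y M‖ ≤ M := by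
    intro y hy
    rw [Real.norm_of_nonneg (le_min hy.le hM0.le)]
    exact min_le_right _ _
  have hstat : ∫ w, min (x 1 w) M ∂P = ∫ w, min (x 0 w) M ∂P := by
    rw [← integral_map (hx.measurable_duration 1).aemeasurable
      (f := fun y => min y M) hmin.aestronglyMeasurable,
      herg.map_eq hx.measurable_duration, integral_map hx0.aemeasurable hmin.aestronglyMeasurable]
  have hi1 : Integrable (fun w => min (rate θ (x 0 w)) M) P := by
    refine .of_bound (hmin.comp ((measurable_rate θ).comp hx0)).aestronglyMeasurable M ?_
    filter_upwards [hx.duration_pos 0] with w hw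
    exact hbd (rate_pos h0 h1 hw)
  have hi0 : Integrable (fun w => min (x 0 w) M) P := by
    refine .of_bound (hmin.comp hx0).aestronglyMeasurable M ?_
    filter_upwards [hx.duration_pos 0] with w hw
    exact hbd hw
  have hAi : IntegrableOn (fun w => θ 0 - (1 - θ 1) * x 0 w) A P :=
    (integrable_const _).sub ((hon n).const_mul _)
  -- Off `A` the integrand is nonpositive. By stationarity and `integral_min_le` the left side is
  -- nonnegative, so `(1 - α) E[x₀; A] ≤ ω`, uniformly in `M`.
  have hle : ∫ w, (min (rate θ (x 0 w)) M - min (x 0 w) M) ∂P ≤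
      ∫ w in A, (θ 0 - (1 - θ 1) * x 0 w) ∂P := by
    rw [← integral_indicator hAm]
    refine integral_mono (hi1.sub hi0) ((integrable_indicator_iff hAm).mpr hAi) fun w => ?_
    by_cases hw : w ∈ A
    · rw [Set.indicator_of_mem hw, min_eq_left (a := x 0 w) hw]
      have := min_le_left (rate θ (x 0 w)) M
      simp only [rate] at this ⊢
      linarith
    · rw [Set.indicator_of_notMem hw, min_eq_right (a := x 0 w) (not_le.mp hw).le]
      have := min_le_right (rate θ (x 0 w)) M
      linarith
  rw [integral_sub hi1 hi0, integral_sub (integrable_const _) ((hon n).const_mul _),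
    integral_const_mul] at hle
  have hmain := hx.integral_min_le h0 h1 hM0
  have hPA : ∫ _ in A, θ 0 ∂P ≤ θ 0 := by
    rw [setIntegral_const, smul_eq_mul]
    exact mul_le_of_le_one_left h0.le measureReal_le_one
  rw [le_div_iff₀ (by linarith)]
  linarith

lemma IsACD.integral_duration_pos [IsProbabilityMeasure P] (hx : IsACD P θ ε x)
    (hi : Integrable (x 0) P) : 0 < ∫ w, x 0 w ∂P := by
  have h := hx.duration_pos 0
  refine (integral_nonneg_of_ae (h.mono fun w hw => hw.le)).lt_of_ne' fun h0 => ?_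
  rw [integral_eq_zero_iff_of_nonneg_ae (h.mono fun w hw => hw.le) hi] at h0
  obtain ⟨w, hw1, hw2⟩ := (h.and h0).exists
  exact hw1.ne' hw2

end ACD

/-! ### Random time change, residuals and the limiting covariance -/

namespace ACD

section Deterministic

lemma tendsto_inv_mul_sum {f : ℕ → ℝ} {n : ℝ → ℕ} {r l : ℝ}
    (hf : Tendsto (fun n : ℕ => (n : ℝ)⁻¹ * ∑ i ∈ Finset.range n, f i) atTop (𝓝 l))
    (hn : Tendsto n atTop atTop) (hr : Tendsto (fun T : ℝ => T⁻¹ * (n T : ℝ)) atTop (𝓝 r)) :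
    Tendsto (fun T : ℝ => T⁻¹ * ∑ i ∈ Finset.range (n T), f i) atTop (𝓝 (r * l)) := by
  refine (hr.mul (hf.comp hn)).congr' ?_
  filter_upwards [hn.eventually_gt_atTop 0] with T hT
  have : (n T : ℝ) ≠ 0 := by positivity
  simp only [Function.comp]
  field_simp

variable {x : ℕ → ℝ} {m : ℝ}

lemma tendsto_count_add_one_div (hpos : ∀ i, 0 < x i) (hm : 0 < m)
    (hlim : Tendsto (fun n : ℕ => (n : ℝ)⁻¹ * ∑ i ∈ Finset.range n, x (i + 1)) atTop (𝓝 m)) :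
    Tendsto (fun T : ℝ => T⁻¹ * ((count x T + 1 : ℕ) : ℝ)) atTop (𝓝 m⁻¹) := by
  have h := (tendsto_count_div hpos hm hlim).add tendsto_inv_atTop_zero
  rw [add_zero] at h
  refine h.congr fun T => ?_
  push_cast
  ring

/-- Supplies a deterministic number of terms for the central limit theorem; any slope above `m⁻¹`
would do. -/
lemma eventually_count_lt (hpos : ∀ i, 0 < x i) (hm : 0 < m)
    (hlim : Tendsto (fun n : ℕ => (n : ℝ)⁻¹ * ∑ i ∈ Finset.range n, x (i + 1)) atTop (𝓝 m)) :
    ∀ᶠ T : ℝ in atTop, count x T + 1 ≤ ⌈(m⁻¹ + 1) * T⌉₊ := by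
  filter_upwards [(tendsto_count_add_one_div hpos hm hlim).eventually
    (gt_mem_nhds (lt_add_one m⁻¹)), eventually_gt_atTop 0] with T hT hT0
  have h1 : ((count x T + 1 : ℕ) : ℝ) ≤ (m⁻¹ + 1) * T := by
    rw [inv_mul_lt_iff₀ hT0] at hT
    linarith
  exact_mod_cast h1.trans (Nat.le_ceil _)

lemma sum_range_ite_eq (hpos : ∀ i, 0 < x i)
    (htop : Tendsto (fun n : ℕ => ∑ i ∈ Finset.range n, x (i + 1)) atTop atTop) {T : ℝ}
    (hT : 0 ≤ T) {K : ℕ} (hK : count x T + 1 ≤ K) (f : ℕ → ℝ) :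
    ∑ j ∈ Finset.range K, (if ∑ i ∈ Finset.range j, x (i + 1) ≤ T then f j else 0) =
      ∑ j ∈ Finset.range (count x T + 1), f j := by
  rw [← Finset.sum_filter]
  refine Finset.sum_congr ?_ fun _ _ => rfl
  ext j
  simp only [Finset.mem_filter, Finset.mem_range, ← lt_count_add_one_iff hpos htop hT]
  omega

/-- The last term of a sum of squares is negligible at the scale `√T`. -/
lemma tendsto_inv_sqrt_mul_last {f : ℕ → ℝ} {l : ℝ} (hpos : ∀ i, 0 < x i) (hm : 0 < m)
    (hlim : Tendsto (fun n : ℕ => (n : ℝ)⁻¹ * ∑ i ∈ Finset.range n, x (i + 1)) atTop (𝓝 m))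
    (hf : Tendsto (fun n : ℕ => (n : ℝ)⁻¹ * ∑ i ∈ Finset.range n, f i ^ 2) atTop (𝓝 l)) :
    Tendsto (fun T : ℝ => (√T)⁻¹ * |f (count x T)|) atTop (𝓝 0) := by
  have hN := tendsto_count_atTop hpos (tendsto_sum_atTop hm hlim)
  have h1 := tendsto_inv_mul_sum hf ((tendsto_add_atTop_nat 1).comp hN)
    (tendsto_count_add_one_div hpos hm hlim)
  have h2 := tendsto_inv_mul_sum hf hN (tendsto_count_div hpos hm hlim)
  -- The last square over `T` is the difference of two normalized sums with the same limit.
  have h3 := (h1.sub h2).sqrt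
  rw [sub_self, Real.sqrt_zero] at h3
  refine h3.congr fun T => ?_
  simp only [Function.comp, Finset.sum_range_succ]
  rw [← mul_sub, add_sub_cancel_left, mul_comm, Real.sqrt_mul (sq_nonneg _), Real.sqrt_inv,
    Real.sqrt_sq_eq_abs, mul_comm]

end Deterministic

/-- The rate dominates both `ω` and `α y`. This boundedness spares any second moment of the
durations. -/
lemma abs_vvec_le {θ : EuclideanSpace ℝ (Fin 2)} (h0 : 0 < θ 0) (h1 : 0 < θ 1) {y : ℝ}
    (hy : 0 < y) (j : Fin 2) : |vvec θ y j| ≤ (θ 0)⁻¹ + (θ 1)⁻¹ := by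
  have hr := rate_pos h0 h1 hy
  have hr0 : θ 0 ≤ rate θ y := by simp only [rate]; nlinarith
  have hr1 : θ 1 * y ≤ rate θ y := by simp only [rate]; linarith
  have hi0 : 0 < (θ 0)⁻¹ := by positivity
  have hi1 : 0 < (θ 1)⁻¹ := by positivity
  rw [vvec_apply]
  fin_cases j
  · simp only [Fin.zero_eta, Matrix.cons_val_zero, mul_one]
    rw [abs_of_pos (by positivity)]
    have : (rate θ y)⁻¹ ≤ (θ 0)⁻¹ := by gcongr
    linarith
  · simp only [Fin.mk_one, Matrix.cons_val_one, Matrix.cons_val_fin_one]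
    rw [abs_of_pos (by positivity), inv_mul_eq_div]
    have : y / rate θ y ≤ (θ 1)⁻¹ := by
      rw [div_le_iff₀ hr, inv_mul_eq_div, le_div_iff₀ h1]
      linarith
    linarith

lemma measurable_vvec (θ : EuclideanSpace ℝ (Fin 2)) (j : Fin 2) :
    Measurable fun y => vvec θ y j := by
  have := measurable_rate θ
  simp only [vvec_apply]
  refine this.inv.mul ?_
  fin_cases j
  · simp
  · simpa using measurable_id'

lemma measurable_resid (θ : EuclideanSpace ℝ (Fin 2)) :
    Measurable fun q : ℝ × ℝ => resid θ q.1 q.2 := by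
  have := measurable_rate θ
  unfold resid
  fun_prop

variable {Ω : Type*} [mΩ : MeasurableSpace Ω] {P : Measure Ω} {θ : EuclideanSpace ℝ (Fin 2)}
  {ε x : ℕ → Ω → ℝ}

/-- The natural filtration of the durations. -/
abbrev history (x : ℕ → Ω → ℝ) (k : ℕ) : MeasurableSpace Ω :=
  MeasurableSpace.comap (fun w (j : Fin (k + 1)) => x j w) inferInstance

omit mΩ in
lemma measurable_history {j k : ℕ} (h : j ≤ k) : Measurable[history x k] (x j) :=
  (measurable_pi_apply (⟨j, Nat.lt_succ_of_le h⟩ : Fin (k + 1))).comp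
    (comap_measurable fun w (j : Fin (k + 1)) => x j w)

omit mΩ in
lemma monotone_history : Monotone (history x) := fun k l h => by
  refine measurable_iff_comap_le.mp ?_
  exact @measurable_pi_lambda _ _ _ (history x l) _ _ fun j => measurable_history (by omega)

lemma history_le (hm : ∀ i, Measurable (x i)) (k : ℕ) : history x k ≤ mΩ :=
  measurable_iff_comap_le.mp (measurable_pi_lambda _ fun j => hm j)

/-- The residual replaces `ε - 1` as noise because it is a function of the path, hence adapted to
`history` exactly and not just almost everywhere. -/
lemma IsACD.resid_ae_eq (hx : IsACD P θ ε x) (h0 : 0 < θ 0) (h1 : 0 < θ 1) (k : ℕ) :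
    (fun w => resid θ (x k w) (x (k + 1) w)) =ᵐ[P] fun w => ε (k + 1) w - 1 := by
  filter_upwards [hx.equation k, hx.duration_pos k] with w hw1 hw2
  rw [resid, hw1, mul_div_cancel_left₀ _ (rate_pos h0 h1 hw2).ne']

lemma IsACD.measurable_resid (hx : IsACD P θ ε x) (k : ℕ) :
    Measurable fun w => resid θ (x k w) (x (k + 1) w) :=
  (ACD.measurable_resid θ).comp ((hx.measurable_duration k).prodMk (hx.measurable_duration _))

lemma IsACD.indep_resid (hx : IsACD P θ ε x) (h0 : 0 < θ 0) (h1 : 0 < θ 1) (k : ℕ) :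
    Indep (history x k)
      (MeasurableSpace.comap (fun w => resid θ (x k w) (x (k + 1) w)) inferInstance) P := by
  have h := (hx.indepFun_past k).symm.comp measurable_id
    (measurable_id.sub_const (1 : ℝ) : Measurable fun y : ℝ => y - 1)
  exact (h.congr EventuallyEq.rfl (hx.resid_ae_eq h0 h1 k).symm)

lemma IsACD.map_resid (hx : IsACD P θ ε x) (h0 : 0 < θ 0) (h1 : 0 < θ 1) (k : ℕ) :
    P.map (fun w => resid θ (x k w) (x (k + 1) w)) =
      P.map fun w => resid θ (x 0 w) (x 1 w) := by
  rw [Measure.map_congr (hx.resid_ae_eq h0 h1 k), Measure.map_congr (hx.resid_ae_eq h0 h1 0)]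
  exact ((hx.identDistrib_innovation k).comp (measurable_id.sub_const (1 : ℝ))).map_eq

lemma IsACD.integral_resid_sq (hx : IsACD P θ ε x) (h0 : 0 < θ 0) (h1 : 0 < θ 1) :
    ∫ w, resid θ (x 0 w) (x 1 w) ^ 2 ∂P = variance (ε 1) P := by
  rw [variance_eq_integral (hx.measurable_innovation 0).aemeasurable, hx.integral_innovation]
  refine integral_congr_ae ?_
  filter_upwards [hx.resid_ae_eq h0 h1 0] with w hw
  rw [hw]

variable [IsProbabilityMeasure P]

lemma IsACD.memLp_resid (hx : IsACD P θ ε x) (h0 : 0 < θ 0) (h1 : 0 < θ 1)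
    (hsq : MemLp (ε 1) 2 P) : MemLp (fun w => resid θ (x 0 w) (x 1 w)) 2 P :=
  (memLp_congr_ae (hx.resid_ae_eq h0 h1 0)).mpr (hsq.sub (memLp_const 1))

lemma IsACD.integral_resid (hx : IsACD P θ ε x) (h0 : 0 < θ 0) (h1 : 0 < θ 1) :
    ∫ w, resid θ (x 0 w) (x 1 w) ∂P = 0 := by
  rw [integral_congr_ae (hx.resid_ae_eq h0 h1 0),
    integral_sub hx.integrable_innovation (integrable_const _), hx.integral_innovation]
  simp

lemma IsACD.integrable_vvec_mul (hx : IsACD P θ ε x) (h0 : 0 < θ 0) (h1 : 0 < θ 1)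
    (j k : Fin 2) : Integrable (fun w => vvec θ (x 0 w) j * vvec θ (x 0 w) k) P := by
  have hm := fun i => (measurable_vvec θ i).comp (hx.measurable_duration 0)
  refine .of_bound ((hm j).mul (hm k)).aestronglyMeasurable
    (((θ 0)⁻¹ + (θ 1)⁻¹) * ((θ 0)⁻¹ + (θ 1)⁻¹)) ?_
  filter_upwards [hx.duration_pos 0] with w hw
  rw [norm_mul]
  exact mul_le_mul (abs_vvec_le h0 h1 hw j) (abs_vvec_le h0 h1 hw k) (norm_nonneg _)
    (by positivity)

/-- The summands of the observed information have mean `E[v₁ v₁']`. -/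
lemma IsACD.integral_information_term (hx : IsACD P θ ε x) (h0 : 0 < θ 0) (h1 : 0 < θ 1)
    (j k : Fin 2) :
    Integrable (fun w => (2 * resid θ (x 0 w) (x 1 w) + 1) *
      (vvec θ (x 0 w) j * vvec θ (x 0 w) k)) P ∧
    ∫ w, (2 * resid θ (x 0 w) (x 1 w) + 1) * (vvec θ (x 0 w) j * vvec θ (x 0 w) k) ∂P =
      infoMatrix P x θ j k := by
  have hri : Integrable (fun w => resid θ (x 0 w) (x 1 w)) P :=
    (integrable_congr (hx.resid_ae_eq h0 h1 0)).mpr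
      (hx.integrable_innovation.sub (integrable_const _))
  have hvi := hx.integrable_vvec_mul h0 h1 j k
  have hind : IndepFun (fun w => resid θ (x 0 w) (x 1 w))
      (fun w => vvec θ (x 0 w) j * vvec θ (x 0 w) k) P := by
    have h := (hx.indepFun_last 0).comp (measurable_id.sub_const (1 : ℝ))
      ((measurable_vvec θ j).mul (measurable_vvec θ k))
    exact h.congr (hx.resid_ae_eq h0 h1 0).symm EventuallyEq.rfl
  have hpi : Integrable (fun w => resid θ (x 0 w) (x 1 w) *
      (vvec θ (x 0 w) j * vvec θ (x 0 w) k)) P := hind.integrable_mul hri hvi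
  have hexp : ∀ w, (2 * resid θ (x 0 w) (x 1 w) + 1) * (vvec θ (x 0 w) j * vvec θ (x 0 w) k) =
      2 * (resid θ (x 0 w) (x 1 w) * (vvec θ (x 0 w) j * vvec θ (x 0 w) k)) +
        vvec θ (x 0 w) j * vvec θ (x 0 w) k := fun w => by ring
  simp_rw [hexp]
  refine ⟨(hpi.const_mul 2).add hvi, ?_⟩
  have hmul := hind.integral_fun_mul_eq_mul_integral hri.aestronglyMeasurable
    hvi.aestronglyMeasurable
  rw [hx.integral_resid h0 h1, zero_mul] at hmul
  rw [integral_add (hpi.const_mul 2) hvi, integral_const_mul, hmul]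
  simp [infoMatrix]

/-- Serves twice: for positive semidefiniteness, and to match the conditional variance with the
Gaussian exponent. -/
lemma IsACD.dotProduct_infoMatrix (hx : IsACD P θ ε x) (h0 : 0 < θ 0) (h1 : 0 < θ 1)
    (t : Fin 2 → ℝ) :
    t ⬝ᵥ (infoMatrix P x θ).mulVec t = ∫ w, (∑ j, vvec θ (x 0 w) j * t j) ^ 2 ∂P := by
  have hi := fun j k => hx.integrable_vvec_mul h0 h1 j k
  have hexp : ∀ w, (∑ j, vvec θ (x 0 w) j * t j) ^ 2 =
      ∑ j, ∑ k, t j * t k * (vvec θ (x 0 w) j * vvec θ (x 0 w) k) := by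
    intro w
    simp only [Fin.sum_univ_two]
    ring
  simp_rw [hexp]
  rw [integral_finsetSum _ fun j _ => integrable_finsetSum _ fun k _ => (hi j k).const_mul _]
  simp_rw [integral_finsetSum _ fun k _ => (hi _ k).const_mul _, integral_const_mul]
  simp only [dotProduct, Matrix.mulVec, infoMatrix, Matrix.of_apply, Finset.mul_sum]
  refine Finset.sum_congr rfl fun j _ => Finset.sum_congr rfl fun k _ => ?_
  ring

lemma IsACD.posSemidef_infoMatrix (hx : IsACD P θ ε x) (h0 : 0 < θ 0) (h1 : 0 < θ 1) :
    (infoMatrix P x θ).PosSemidef := by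
  refine Matrix.PosSemidef.of_dotProduct_mulVec_nonneg ?_ fun t => ?_
  · ext j k
    simp [infoMatrix, mul_comm]
  · rw [star_trivial, hx.dotProduct_infoMatrix h0 h1]
    exact integral_nonneg fun w => sq_nonneg _

end ACD

/-! ### Limits of the score and of the information -/

namespace ACD

variable {Ω : Type*} [mΩ : MeasurableSpace Ω] {P : Measure Ω} {θ : EuclideanSpace ℝ (Fin 2)}
  {ε x : ℕ → Ω → ℝ}

variable [IsProbabilityMeasure P]

lemma IsACD.ae_tendsto_duration (hx : IsACD P θ ε x) (herg : IsStationaryErgodic P x)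
    (hi : Integrable (x 0) P) :
    ∀ᵐ w ∂P, Tendsto (fun n : ℕ => (n : ℝ)⁻¹ * ∑ i ∈ Finset.range n, x (i + 1) w) atTop
      (𝓝 (∫ w, x 0 w ∂P)) := by
  have hid : IdentDistrib (x 1) (x 0) P P :=
    ⟨(hx.measurable_duration 1).aemeasurable, (hx.measurable_duration 0).aemeasurable,
      herg.map_eq hx.measurable_duration⟩
  rw [← hid.integral_eq]
  exact herg.ae_tendsto hx.measurable_duration (F := fun q => q.2) measurable_snd
    (hid.integrable_iff.mpr hi)

lemma measurable_vvec_vector (θ : EuclideanSpace ℝ (Fin 2)) : Measurable (vvec θ) :=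
  (WithLp.measurable_toLp 2 (Fin 2 → ℝ)).comp (measurable_pi_lambda _ (measurable_vvec θ))

lemma score_eq_of_pos {y : ℕ → ℝ} (h0 : 0 < θ 0) (h1 : 0 < θ 1) (hy : ∀ i, 0 < y i) (T : ℝ) :
    score y T θ = ∑ i ∈ Finset.range (count y T), resid θ (y i) (y (i + 1)) • vvec θ (y i) :=
  score_eq fun i => (rate_pos h0 h1 (hy i)).ne'

/-- The random upper limit is traded for indicators; the resulting sums are eventually constant in
`n` on almost every path. -/
lemma IsACD.aemeasurable_score (hx : IsACD P θ ε x) (h0 : 0 < θ 0) (h1 : 0 < θ 1)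
    (herg : IsStationaryErgodic P x) (hi : Integrable (x 0) P) (T : ℝ) :
    AEMeasurable (fun w => score (fun i => x i w) T θ) P := by
  have hS : ∀ k, Measurable fun w => ∑ i ∈ Finset.range k, x (i + 1) w := fun k =>
    Finset.measurable_sum _ fun i _ => hx.measurable_duration _
  refine aemeasurable_of_tendsto_metrizable_ae atTop
    (f := fun (n : ℕ) w => ∑ i ∈ Finset.range n,
      if ∑ l ∈ Finset.range (i + 1), x (l + 1) w ≤ T then
        resid θ (x i w) (x (i + 1) w) • vvec θ (x i w) else 0) (fun n => ?_) ?_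
  · refine (Finset.measurable_sum _ fun i _ => Measurable.ite ?_ ?_ measurable_const).aemeasurable
    · exact measurableSet_le (hS _) measurable_const
    · exact (hx.measurable_resid i).smul
        ((measurable_vvec_vector θ).comp (hx.measurable_duration i))
  · filter_upwards [hx.ae_pos, hx.ae_tendsto_duration herg hi] with w hpos hlim
    have htop := tendsto_sum_atTop (x := fun i => x i w) (hx.integral_duration_pos hi) hlim
    rw [score_eq_of_pos h0 h1 hpos]
    refine tendsto_const_nhds.congr' ?_
    filter_upwards [eventually_ge_atTop (count (fun i => x i w) T)] with n hn
    rw [← Finset.sum_filter]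
    refine Finset.sum_congr ?_ fun _ _ => rfl
    ext i
    simp only [Finset.mem_filter, Finset.mem_range, ← lt_count_iff hpos htop]
    omega

/-- The linear combination `⟨v, t⟩` of the coordinates of `v = (1, y)' / ψ`. -/
noncomputable def proj (θ : EuclideanSpace ℝ (Fin 2)) (t : Fin 2 → ℝ) (y : ℝ) : ℝ :=
  ∑ j, vvec θ y j * t j

lemma measurable_proj (θ : EuclideanSpace ℝ (Fin 2)) (t : Fin 2 → ℝ) : Measurable (proj θ t) :=
  Finset.measurable_sum _ fun j _ => (measurable_vvec θ j).mul_const _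

lemma abs_proj_le (h0 : 0 < θ 0) (h1 : 0 < θ 1) (t : Fin 2 → ℝ) {y : ℝ} (hy : 0 < y) :
    |proj θ t y| ≤ ∑ j, ((θ 0)⁻¹ + (θ 1)⁻¹) * |t j| := by
  refine (Finset.abs_sum_le_sum_abs _ _).trans (Finset.sum_le_sum fun j _ => ?_)
  rw [abs_mul]
  gcongr
  exact abs_vvec_le h0 h1 hy j

lemma inner_vvec (t : EuclideanSpace ℝ (Fin 2)) (y : ℝ) : inner ℝ (vvec θ y) t = proj θ t y := by
  simp [proj, PiLp.inner_apply, mul_comm]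

lemma IsACD.integrable_proj_sq (hx : IsACD P θ ε x) (h0 : 0 < θ 0) (h1 : 0 < θ 1)
    (t : Fin 2 → ℝ) : Integrable (fun w => proj θ t (x 0 w) ^ 2) P := by
  refine .of_bound (((measurable_proj θ t).comp (hx.measurable_duration 0)).pow_const
    2).aestronglyMeasurable ((∑ j, ((θ 0)⁻¹ + (θ 1)⁻¹) * |t j|) ^ 2) ?_
  filter_upwards [hx.duration_pos 0] with w hw
  rw [norm_pow]
  exact pow_le_pow_left₀ (norm_nonneg _) (abs_proj_le h0 h1 t hw) 2

/-- The score at `√T` scale is, along a path, asymptotically equal to a sum with predictable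
coefficients and a deterministic number of terms. -/
lemma tendsto_score_sub {y : ℕ → ℝ} {m l : ℝ} (h0 : 0 < θ 0) (h1 : 0 < θ 1)
    (t : EuclideanSpace ℝ (Fin 2)) (hpos : ∀ i, 0 < y i) (hm : 0 < m)
    (hlim : Tendsto (fun n : ℕ => (n : ℝ)⁻¹ * ∑ i ∈ Finset.range n, y (i + 1)) atTop (𝓝 m))
    (hsq : Tendsto (fun n : ℕ => (n : ℝ)⁻¹ *
      ∑ i ∈ Finset.range n, (resid θ (y i) (y (i + 1))) ^ 2) atTop (𝓝 l)) :
    Tendsto (fun T : ℝ => ∑ j ∈ Finset.range ⌈(m⁻¹ + 1) * T⌉₊,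
        (if ∑ i ∈ Finset.range j, y (i + 1) ≤ T then (√T)⁻¹ * proj θ t (y j) else 0) *
          resid θ (y j) (y (j + 1)) - inner ℝ ((√T)⁻¹ • score y T θ) t) atTop (𝓝 0) := by
  have htop := tendsto_sum_atTop hm hlim
  set C : ℝ := ∑ j, ((θ 0)⁻¹ + (θ 1)⁻¹) * |t j| with hC
  have hlast := (tendsto_inv_sqrt_mul_last hpos hm hlim hsq).mul_const C
  rw [zero_mul] at hlast
  refine squeeze_zero_norm' ?_ hlast
  filter_upwards [eventually_count_lt hpos hm hlim, eventually_ge_atTop 0] with T hT hT0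
  simp_rw [ite_mul, zero_mul]
  rw [sum_range_ite_eq hpos htop hT0 hT, score_eq_of_pos h0 h1 hpos, inner_smul_left, sum_inner,
    Finset.sum_range_succ, Finset.mul_sum]
  simp_rw [inner_smul_left, inner_vvec]
  simp only [conj_trivial]
  have : ∀ i, (√T)⁻¹ * (resid θ (y i) (y (i + 1)) * proj θ t (y i)) =
      (√T)⁻¹ * proj θ t (y i) * resid θ (y i) (y (i + 1)) := fun i => by ring
  simp_rw [this]
  -- Only the term `j = N_T` survives: the indicator keeps indices below `N_T + 1`, the score those
  -- below `N_T`.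
  rw [add_sub_cancel_left, norm_mul, norm_mul, Real.norm_of_nonneg (by positivity),
    mul_right_comm]
  exact mul_le_mul_of_nonneg_left (abs_proj_le h0 h1 t (hpos _)) (by positivity)

/-- Pointwise convergence of the characteristic function of the normalized score. -/
theorem IsACD.tendsto_charFun_score (hx : IsACD P θ ε x) (h0 : 0 < θ 0) (h1 : 0 < θ 1)
    (hsq : MemLp (ε 1) 2 P) (herg : IsStationaryErgodic P x) (hi : Integrable (x 0) P)
    (t : EuclideanSpace ℝ (Fin 2)) :
    Tendsto (fun T : ℝ => charFun (P.map fun w => (√T)⁻¹ • score (fun i => x i w) T θ) t) atTop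
      (𝓝 (Complex.exp (-((variance (ε 1) P * ((∫ w, x 0 w ∂P)⁻¹ *
        ∫ w, proj θ t (x 0 w) ^ 2 ∂P) / 2 : ℝ))))) := by
  set m : ℝ := ∫ w, x 0 w ∂P with hm
  have hm0 : 0 < m := hx.integral_duration_pos hi
  have hdur := hx.ae_tendsto_duration herg hi
  have hmem := hx.memLp_resid h0 h1 hsq
  have hmres := fun k => hx.measurable_resid k
  have hressq := herg.ae_tendsto hx.measurable_duration
    (F := fun q => resid θ q.1 q.2 ^ 2) ((ACD.measurable_resid θ).pow_const 2) hmem.integrable_sq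
  have hproj := herg.ae_tendsto hx.measurable_duration
    (F := fun q => proj θ t q.1 ^ 2) (((measurable_proj θ t).comp measurable_fst).pow_const 2)
    (hx.integrable_proj_sq h0 h1 t)
  set C : ℝ := ∑ j, ((θ 0)⁻¹ + (θ 1)⁻¹) * |t j| with hC
  have hC0 : 0 ≤ C := Finset.sum_nonneg fun j _ => by positivity
  set K : ℝ → ℕ := fun T => ⌈(m⁻¹ + 1) * T⌉₊ with hK
  set a : ℝ → ℕ → Ω → ℝ := fun T j w =>
    if ∑ i ∈ Finset.range j, x (i + 1) w ≤ T then (√T)⁻¹ * proj θ t (x j w) else 0 with ha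
  have ham : ∀ T k, Measurable[history x k] (a T k) := by
    intro T k
    refine Measurable.ite ?_ ?_ measurable_const
    · refine measurableSet_le (Finset.measurable_sum _ fun i hik => ?_) measurable_const
      exact measurable_history (Finset.mem_range.mp hik)
    · exact ((measurable_proj θ t).comp (measurable_history le_rfl)).const_mul _
  have hem : ∀ k, Measurable[history x (k + 1)] fun w => resid θ (x k w) (x (k + 1) w) :=
    fun k => (ACD.measurable_resid θ).comp
      ((measurable_history (Nat.le_succ k)).prodMk (measurable_history le_rfl))
  -- Eventually the indicator cuts the sum at `N_T + 1`, leaving an ergodic average of `proj²` times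
  -- `(N_T + 1) / T`.
  have hV : ∀ᵐ w ∂P, Tendsto (fun T => (∫ w, resid θ (x 0 w) (x 1 w) ^ 2 ∂P) *
      ∑ j ∈ Finset.range (K T), a T j w ^ 2) atTop
      (𝓝 (variance (ε 1) P * (m⁻¹ * ∫ w, proj θ t (x 0 w) ^ 2 ∂P))) := by
    rw [hx.integral_resid_sq h0 h1]
    filter_upwards [hx.ae_pos, hdur, hproj] with w hpos hlim hp
    have htop := tendsto_sum_atTop (x := fun i => x i w) hm0 hlim
    have hN := tendsto_count_atTop hpos htop
    refine Tendsto.const_mul _ ?_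
    refine (tendsto_inv_mul_sum hp ((tendsto_add_atTop_nat 1).comp hN)
      (tendsto_count_add_one_div hpos hm0 hlim)).congr' ?_
    filter_upwards [eventually_count_lt hpos hm0 hlim, eventually_ge_atTop 0] with T hT hT0
    simp only [ha, ite_pow, ne_eq, OfNat.ofNat_ne_zero, not_false_eq_true, zero_pow]
    rw [sum_range_ite_eq (x := fun i => x i w) hpos htop hT0 hT, Finset.mul_sum]
    refine Finset.sum_congr rfl fun j _ => ?_
    rw [mul_pow, inv_pow, Real.sq_sqrt hT0]
  have haη : ∀ T, ∀ᵐ w ∂P, ∀ j, |a T j w| ≤ (√T)⁻¹ * C := by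
    intro T
    filter_upwards [hx.ae_pos] with w hpos j
    simp only [ha]
    split_ifs
    · rw [abs_mul, abs_of_nonneg (by positivity : 0 ≤ (√T)⁻¹)]
      gcongr
      exact abs_proj_le h0 h1 t (hpos j)
    · rw [abs_zero]
      positivity
  have hη : Tendsto (fun T : ℝ => (√T)⁻¹ * C) atTop (𝓝 0) := by
    simpa using (Real.tendsto_sqrt_atTop.inv_tendsto_atTop).mul_const C
  have hKη : ∀ᶠ T in atTop, (K T : ℝ) * ((√T)⁻¹ * C) ^ 2 ≤ (m⁻¹ + 2) * C ^ 2 := by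
    filter_upwards [eventually_ge_atTop 1] with T hT
    have hT0 : 0 < T := by linarith
    -- The ceiling costs at most `1 ≤ T`.
    have h2 : (K T : ℝ) ≤ (m⁻¹ + 2) * T := by
      have := Nat.ceil_lt_add_one (a := (m⁻¹ + 1) * T) (by positivity)
      simp only [hK]
      linarith
    rw [mul_pow, inv_pow, Real.sq_sqrt hT0.le, ← mul_assoc]
    gcongr
    rw [← div_eq_mul_inv, div_le_iff₀ hT0]
    exact h2
  have hclt := MartingaleCLT.tendsto_integral_cexp_sum (e := fun k w => resid θ (x k w)
    (x (k + 1) w)) (history_le hx.measurable_duration) monotone_history ham hem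
    (hx.indep_resid h0 h1) (hx.map_resid h0 h1) hmem (hx.integral_resid h0 h1) haη hη hKη hV
  have hSm : ∀ T : ℝ, AEMeasurable (fun w => (√T)⁻¹ • score (fun i => x i w) T θ) P :=
    fun T => (hx.aemeasurable_score h0 h1 herg hi T).fun_const_smul (√T)⁻¹
  have hMm : ∀ T, Measurable fun w =>
      ∑ j ∈ Finset.range (K T), a T j w * resid θ (x j w) (x (j + 1) w) := fun T =>
    Finset.measurable_sum _ fun j _ =>
      ((ham T j).mono (history_le hx.measurable_duration j) le_rfl).mul (hmres j)
  have hIm : ∀ T : ℝ, AEMeasurable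
      (fun w => inner ℝ ((√T)⁻¹ • score (fun i => x i w) T θ) t) P :=
    fun T => (hSm T).inner_const
  have hcm : ∀ T : ℝ, AEStronglyMeasurable (fun w => Complex.exp
      ((inner ℝ ((√T)⁻¹ • score (fun i => x i w) T θ) t : ℝ) * Complex.I)) P := fun T =>
    (Complex.measurable_exp.comp_aemeasurable
      ((Complex.measurable_ofReal.comp_aemeasurable (hIm T)).mul_const
        Complex.I)).aestronglyMeasurable
  have hcM : ∀ T : ℝ, AEStronglyMeasurable (fun w => Complex.exp
      ((∑ j ∈ Finset.range (K T), a T j w * resid θ (x j w) (x (j + 1) w) : ℝ) *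
        Complex.I)) P := fun T =>
    (Complex.measurable_exp.comp ((Complex.measurable_ofReal.comp (hMm T)).mul_const
        Complex.I)).aestronglyMeasurable
  have hdiff : Tendsto (fun T : ℝ => ∫ w, (Complex.exp
      ((∑ j ∈ Finset.range (K T), a T j w * resid θ (x j w) (x (j + 1) w) : ℝ) * Complex.I) -
      Complex.exp ((inner ℝ ((√T)⁻¹ • score (fun i => x i w) T θ) t : ℝ) * Complex.I)) ∂P)
      atTop (𝓝 0) := by
    have hz : (0 : ℂ) = ∫ _ : Ω, 0 ∂P := by simp
    rw [hz]
    refine tendsto_integral_filter_of_dominated_convergence (fun _ => 2)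
      (Eventually.of_forall fun T => (hcM T).sub (hcm T)) ?_ (integrable_const _) ?_
    · refine Eventually.of_forall fun T => Eventually.of_forall fun w => ?_
      refine (norm_sub_le _ _).trans ?_
      rw [Complex.norm_exp_ofReal_mul_I, Complex.norm_exp_ofReal_mul_I]
      norm_num
    · filter_upwards [hx.ae_pos, hdur, hressq] with w hpos hlim hs
      have hsub := tendsto_score_sub (y := fun i => x i w) h0 h1 t hpos hm0 hlim hs
      rw [tendsto_zero_iff_norm_tendsto_zero]
      have hexp : Tendsto (fun u : ℝ => ‖Complex.exp (u * Complex.I) - 1‖) (𝓝 0) (𝓝 0) := by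
        have : Continuous fun u : ℝ => ‖Complex.exp (u * Complex.I) - 1‖ := by fun_prop
        simpa using this.tendsto 0
      refine (hexp.comp hsub).congr fun T => ?_
      simp only [Function.comp, ha, hK]
      generalize (∑ j ∈ Finset.range ⌈(m⁻¹ + 1) * T⌉₊, _ : ℝ) = A
      generalize (inner ℝ ((√T)⁻¹ • score (fun i => x i w) T θ) t : ℝ) = B
      -- Reduces the difference of exponentials to `|exp (i (A - B)) - 1|`, where `A - B → 0`.
      have hAB : Complex.exp (A * Complex.I) =
          Complex.exp (B * Complex.I) * Complex.exp ((A - B : ℝ) * Complex.I) := by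
        rw [← Complex.exp_add]
        push_cast
        ring_nf
      rw [hAB, ← mul_sub_one, norm_mul, Complex.norm_exp_ofReal_mul_I, one_mul]
  have hfin := hclt.sub hdiff
  rw [sub_zero] at hfin
  refine hfin.congr fun T => ?_
  have hb : ∀ {f : Ω → ℝ}, AEStronglyMeasurable (fun w => Complex.exp (f w * Complex.I)) P →
      Integrable (fun w => Complex.exp (f w * Complex.I)) P := fun h =>
    .of_bound h 1 (Eventually.of_forall fun w => (Complex.norm_exp_ofReal_mul_I _).le)
  rw [integral_sub (hb (hcM T)) (hb (hcm T)), sub_sub_cancel, charFun_apply,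
    integral_map (hSm T) (by fun_prop)]

/-- Pathwise law of large numbers for the information, entrywise along the transitions. -/
lemma IsACD.ae_tendsto_information_term (hx : IsACD P θ ε x) (h0 : 0 < θ 0) (h1 : 0 < θ 1)
    (herg : IsStationaryErgodic P x) :
    ∀ᵐ w ∂P, ∀ j k, Tendsto (fun n : ℕ => (n : ℝ)⁻¹ * ∑ i ∈ Finset.range n,
      (2 * resid θ (x i w) (x (i + 1) w) + 1) * (vvec θ (x i w) j * vvec θ (x i w) k)) atTop
      (𝓝 (infoMatrix P x θ j k)) := by
  refine ae_all_iff.mpr fun j => ae_all_iff.mpr fun k => ?_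
  obtain ⟨hint, hval⟩ := hx.integral_information_term h0 h1 j k
  have hF : Measurable fun q : ℝ × ℝ => (2 * resid θ q.1 q.2 + 1) *
      (vvec θ q.1 j * vvec θ q.1 k) :=
    (((ACD.measurable_resid θ).const_mul 2).add_const 1).mul
      (((measurable_vvec θ j).comp measurable_fst).mul
        ((measurable_vvec θ k).comp measurable_fst))
  have h := herg.ae_tendsto hx.measurable_duration hF hint
  rwa [hval] at h

/-- Almost sure convergence of the information normalized by calendar time. -/
theorem IsACD.ae_tendsto_inv_smul_information (hx : IsACD P θ ε x) (h0 : 0 < θ 0) (h1 : 0 < θ 1)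
    (herg : IsStationaryErgodic P x) (hi : Integrable (x 0) P) :
    ∀ᵐ w ∂P, Tendsto (fun T : ℝ => T⁻¹ • information (fun i => x i w) T θ) atTop
      (𝓝 ((∫ w, x 0 w ∂P)⁻¹ • infoMatrix P x θ)) := by
  have hμ := hx.integral_duration_pos hi
  filter_upwards [hx.ae_pos, hx.ae_tendsto_duration herg hi,
    hx.ae_tendsto_information_term h0 h1 herg] with w hpos hlim hw
  have hN := tendsto_count_atTop hpos (tendsto_sum_atTop (x := fun i => x i w) hμ hlim)
  refine tendsto_pi_nhds.mpr fun j => tendsto_pi_nhds.mpr fun k => ?_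
  refine (tendsto_inv_mul_sum (hw j k) hN (tendsto_count_div hpos hμ hlim)).congr fun T => ?_
  rw [Matrix.smul_apply, information_apply h0 h1 hpos, smul_eq_mul]

/-- Almost sure convergence of the information normalized by the number of durations. -/
theorem IsACD.ae_tendsto_inv_count_smul_information (hx : IsACD P θ ε x) (h0 : 0 < θ 0)
    (h1 : 0 < θ 1) (herg : IsStationaryErgodic P x) (hi : Integrable (x 0) P) :
    ∀ᵐ w ∂P, Tendsto (fun T : ℝ => (count (fun i => x i w) T : ℝ)⁻¹ •
      information (fun i => x i w) T θ) atTop (𝓝 (infoMatrix P x θ)) := by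
  have hμ := hx.integral_duration_pos hi
  filter_upwards [hx.ae_pos, hx.ae_tendsto_duration herg hi,
    hx.ae_tendsto_information_term h0 h1 herg] with w hpos hlim hw
  have hN := tendsto_count_atTop hpos (tendsto_sum_atTop (x := fun i => x i w) hμ hlim)
  refine tendsto_pi_nhds.mpr fun j => tendsto_pi_nhds.mpr fun k => ?_
  refine ((hw j k).comp hN).congr fun T => ?_
  rw [Matrix.smul_apply, information_apply h0 h1 hpos, smul_eq_mul, Function.comp]

/-- Asymptotic normality of the score. -/
theorem IsACD.tendstoInDistribution_score (hx : IsACD P θ ε x) (h0 : 0 < θ 0) (h1 : 0 < θ 1)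
    (hsq : MemLp (ε 1) 2 P) (herg : IsStationaryErgodic P x) (hi : Integrable (x 0) P)
    {Ω' : Type*} [MeasurableSpace Ω'] {P' : Measure Ω'} [IsProbabilityMeasure P']
    {Z : Ω' → EuclideanSpace ℝ (Fin 2)}
    (hZ : HasLaw Z (stdGaussian (EuclideanSpace ℝ (Fin 2))) P') :
    TendstoInDistribution (fun (T : ℝ) w => (√T)⁻¹ • score (fun i => x i w) T θ) atTop
      (fun w' => Matrix.toEuclideanCLM (𝕜 := ℝ)
        (CFC.sqrt ((variance (ε 1) P / ∫ w, x 0 w ∂P) • infoMatrix P x θ)) (Z w'))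
      (fun _ => P) P' := by
  set V : Matrix (Fin 2) (Fin 2) ℝ :=
    (variance (ε 1) P / ∫ w, x 0 w ∂P) • infoMatrix P x θ with hV
  have hpsd : V.PosSemidef := (hx.posSemidef_infoMatrix h0 h1).smul
    (div_nonneg (variance_nonneg _ _) (hx.integral_duration_pos hi).le)
  have hA : Measurable fun z : EuclideanSpace ℝ (Fin 2) =>
      Matrix.toEuclideanCLM (𝕜 := ℝ) (CFC.sqrt V) z := by fun_prop
  have hlaw : P'.map (fun w' => Matrix.toEuclideanCLM (𝕜 := ℝ) (CFC.sqrt V) (Z w')) =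
      multivariateGaussian 0 V := by
    rw [multivariateGaussian, ← hZ.map_eq, AEMeasurable.map_map_of_aemeasurable
      (by fun_prop) hZ.aemeasurable]
    simp [Function.comp_def]
  refine ⟨fun T => (hx.aemeasurable_score h0 h1 herg hi T).fun_const_smul (√T)⁻¹,
    hA.comp_aemeasurable hZ.aemeasurable, ?_⟩
  -- Lévy's theorem is applied along sequences, which suffice since `atTop` on `ℝ` is countably
  -- generated.
  refine tendsto_of_seq_tendsto fun u hu => ?_
  refine ProbabilityMeasure.tendsto_of_tendsto_charFun fun t => ?_
  change Tendsto (fun n => charFun (P.map fun w =>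
    (√(u n))⁻¹ • score (fun i => x i w) (u n) θ) t) atTop (𝓝 (charFun (P'.map fun w' =>
      Matrix.toEuclideanCLM (𝕜 := ℝ) (CFC.sqrt V) (Z w')) t))
  rw [hlaw, charFun_multivariateGaussian hpsd]
  have h := (hx.tendsto_charFun_score h0 h1 hsq herg hi t).comp hu
  have hval : (t.ofLp ⬝ᵥ V.mulVec t.ofLp : ℝ) = variance (ε 1) P * ((∫ w, x 0 w ∂P)⁻¹ *
      ∫ w, proj θ t (x 0 w) ^ 2 ∂P) := by
    rw [hV, Matrix.smul_mulVec, dotProduct_smul, hx.dotProduct_infoMatrix h0 h1, smul_eq_mul,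
      div_eq_mul_inv, mul_assoc]
    rfl
  rw [← hval] at h
  simpa [Function.comp_def] using h

end ACD

theorem lemma4 {Ω : Type*} [MeasurableSpace Ω] (P : Measure Ω) [IsProbabilityMeasure P]
    (ω₀ α₀ κ : ℝ) (ε x : ℕ → Ω → ℝ)
    (hω : 0 < ω₀) (hα : 0 < α₀)
    (hx : ACD.IsACD P !₂[ω₀, α₀] ε x)
    (hdens : HasPDF (ε 1) P volume)
    (hsq : MemLp (ε 1) 2 P)
    (hκ : 1 < κ) (hκ_eq : ∫ w, (α₀ * ε 1 w) ^ κ ∂P = 1)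
    (herg : ACD.IsStationaryErgodic P x) :
    let θ₀ : EuclideanSpace ℝ (Fin 2) := !₂[ω₀, α₀]
    let N : ℝ → Ω → ℕ := fun T w => ACD.count (fun i => x i w) T
    let S : ℝ → Ω → EuclideanSpace ℝ (Fin 2) := fun T w => ACD.score (fun i => x i w) T θ₀
    let I : ℝ → Ω → Matrix (Fin 2) (Fin 2) ℝ :=
      fun T w => ACD.information (fun i => x i w) T θ₀
    let τ : ℝ := variance (ε 1) P
    let μ : ℝ := ∫ w, x 0 w ∂P
    let Om : Matrix (Fin 2) (Fin 2) ℝ := ACD.infoMatrix P x θ₀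
    (Integrable (x 0) P ∧ 0 < μ) ∧
    (∀ {Ω' : Type*} [MeasurableSpace Ω'] (P' : Measure Ω') [IsProbabilityMeasure P']
      (Z : Ω' → EuclideanSpace ℝ (Fin 2)),
      HasLaw Z (stdGaussian (EuclideanSpace ℝ (Fin 2))) P' →
      TendstoInDistribution (fun (T : ℝ) w => (√T)⁻¹ • S T w) atTop
        (fun w' => Matrix.toEuclideanCLM (𝕜 := ℝ) (CFC.sqrt ((τ / μ) • Om)) (Z w'))
        (fun _ => P) P') ∧
    (∀ᵐ w ∂P, Tendsto (fun T : ℝ => T⁻¹ • I T w) atTop (𝓝 (μ⁻¹ • Om))) ∧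
    (∀ᵐ w ∂P, Tendsto (fun T : ℝ => (N T w : ℝ)⁻¹ • I T w) atTop (𝓝 Om)) := by
  intro θ₀ N S I τ μ Om
  have h0 : 0 < θ₀ 0 := hω
  have h1 : 0 < θ₀ 1 := hα
  -- The tail index and the density enter only here, through the contraction that yields a finite
  -- mean.
  have hlt : θ₀ 1 < 1 := hx.alpha_lt_one hdens hα hκ hκ_eq
  have hi : Integrable (x 0) P := hx.integrable_duration herg h0 h1 hlt
  exact ⟨⟨hi, hx.integral_duration_pos hi⟩,
    fun P' _ Z hZ => hx.tendstoInDistribution_score h0 h1 hsq herg hi hZ,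
    hx.ae_tendsto_inv_smul_information h0 h1 herg hi,
    hx.ae_tendsto_inv_count_smul_information h0 h1 herg hi⟩
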